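/- Let $I\subset\mathbb R$ be a compact interval. For a differentiable $f:I\to I$ let $\mathrm{Crit}(f)$ be the set of zeros of $Df$, let $J=J(f)$ be the Julia set (the points of $I$ having no neighbourhood in $I$ on which $\{f^n\}_{n\ge 0}$ is equicontinuous), and put $\mathrm{Crit}'(f)=\mathrm{Crit}(f)\cap J$. Let $\mathcal A$ be the class of non-injective differentiable maps $f:I\to I$ such that: $\mathrm{Crit}(f)$ is finite; $Df$ is Hölder continuous; every $c\in\mathrm{Crit}(f)$ is non-flat, i.e. there are $\ell_c\ge 1$ and diffeomorphisms $\varphi,\psi$ of $\mathbb R$ with Hölder continuous derivatives, $\varphi(c)=\psi(f(c))=0$ and $|\psi\circ f|=|\varphi|^{\ell_c}$ near $c$ in $I$; $f(J)=f^{-1}(J)=J$ and $J$ has at least two points; every periodic point $p\in J$, $f^N(p)=p$, $N\ge1$, satisfies $|D(f^N)(p)|>1$; and for every non-empty relatively open $U\subset J$ there is $n\ge0$ with $J\subset f^n(U)$. Below, $f$ is regarded as a map $J\to J$, preimages are taken in $J$, and $\log 0=-\infty$, $0\cdot(\pm\infty)=0$. Let $\mathcal U$ be the set of upper semicontinuous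 $u:J\to\mathbb R\cup\{-\infty\}$ of the form $u(x)=g(x)+\sum_{c\in\mathrm{Crit}'(f)}b_u(c)\log|x-c|$ with $g$ Hölder continuous and $b_u(c)\ge 0$, and put $\Lambda(u)=\{c\in\mathrm{Crit}'(f):b_u(c)>0\}$. For $\Lambda\subset\mathrm{Crit}'(f)$, a $\Lambda$-exceptional set is a non-empty finite $\Sigma\subset J$ with $f(\Sigma)\subset\Sigma$ and $\emptyset\ne f^{-1}(\Sigma)\setminus\Sigma\subset\Lambda$; $u\in\mathcal U$ is non-exceptional if there is no $\Lambda(u)$-exceptional set. Let $\Sigma_{\max}$ be the union of all $\mathrm{Crit}'(f)$-exceptional sets. For upper semicontinuous $\phi:J\to\mathbb R\cup\{-\infty\}$, the hidden pressure is $\widetilde P(f,\phi)=\sup_\nu\big(h_\nu(f)+\int\phi\,d\nu\big)$, the supremum being over all non-atomic $f$-invariant Borel probability measures $\nu$ on $J$, where $h_\nu(f)$ is the measure-theoretic entropy. **Proposition.** Let $f\in\mathcal A$. Then $\Sigma_{\max}$ is finite, and there are numbers $\alpha(\xi)\in(-1,0]$, $\xi\in\Sigma_{\max}$, such that the function $$h(x)=\sum_{\xi\in\Sigma_{\max}}\alpha(\xi)\log|x-\xi|$$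 is lower semicontinuous from $J$ to $\mathbb R\cup\{+\infty\}$, with $h=+\infty$ only at points of $\Sigma_{\max}$, and such that the following holds. There is $G\in\mathcal U$ with $G=\log|Df|+h\circ f-h$ at every point $x\in J$ at which $h(x)$ and $h(f(x))$ are finite (in particular at every point outside the finite set $f^{-1}(\Sigma_{\max})$), and 1. $\widetilde P(f,-tG)=\widetilde P(f,-t\log|Df|)$ for all $t<0$; 2. $\Lambda(G)\subset\mathrm{Crit}'(f)$, and the inclusion is proper if $\Sigma_{\max}\neq\emptyset$; 3. $G$ is non-exceptional; moreover, there is no non-empty finite $\Sigma\subset J$ with $f(\Sigma)\subset\Sigma$ and $f^{-1}(\Sigma)\setminus\Sigma\subset\Lambda(G)$. -/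

import Mathlib

open Set Filter Topology MeasureTheory
open scoped NNReal ENNReal

noncomputable section

/-! ### Measure-theoretic entropy and hidden pressure of a map `T : X → X` -/

section Thermodynamics

variable {X : Type*} [MeasurableSpace X]

/-- The Shannon entropy of the join `P ∨ T⁻¹P ∨ ⋯ ∨ T⁻⁽ⁿ⁻¹⁾P`, where the finite partition is given
by the fibres of `P : X → Fin k`. -/
def joinEntropy (T : X → X) (μ : Measure X) {k : ℕ} (P : X → Fin k) (n : ℕ) : ℝ :=
  ∑ w : Fin n → Fin k, Real.negMulLog (μ.real {x | ∀ i : Fin n, P (T^[i] x) = w i})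

/-- The Kolmogorov–Sinai entropy `h_μ(T)`: the supremum over all finite measurable partitions `P`
of `lim (1/n) H_μ(P ∨ ⋯ ∨ T⁻⁽ⁿ⁻¹⁾P)`. (The limit exists when `μ` is `T`-invariant.) -/
def ksEntropy (T : X → X) (μ : Measure X) : EReal :=
  ⨆ (k : ℕ) (P : X → Fin k) (_ : Measurable P),
    limsup (fun n : ℕ => ((joinEntropy T μ P n / n : ℝ) : EReal)) atTop

/-- The integral of an extended-real-valued function, `∫ φ⁺ - ∫ φ⁻`. For `φ` bounded above and `μ`
finite the first term is finite, so that the value is well defined in `ℝ ∪ {-∞}`. -/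
def extIntegral (μ : Measure X) (φ : X → EReal) : EReal :=
  ((∫⁻ x, (φ x).toENNReal ∂μ : ℝ≥0∞) : EReal) - ((∫⁻ x, (-φ x).toENNReal ∂μ : ℝ≥0∞) : EReal)

/-- The free energy `h_μ(T) + ∫ φ dμ`. -/
def freeEnergy (T : X → X) (φ : X → EReal) (μ : Measure X) : EReal :=
  ksEntropy T μ + extIntegral μ φ

/-- The hidden pressure: the supremum of the free energy over all non-atomic `T`-invariant
probability measures. -/
def hiddenPressure (T : X → X) (φ : X → EReal) : EReal :=
  ⨆ (μ : Measure X) (_ : IsProbabilityMeasure μ) (_ : MeasurePreserving T μ μ) (_ : NullSingletonClass μ),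
    freeEnergy T φ μ

end Thermodynamics

/-! ### The class of interval maps

The interval is `I = Icc a b`; only the values of `f : ℝ → ℝ` on `I` matter. -/

/-- Hölder continuity on a set of reals. -/
def IsHolderOn (g : ℝ → ℝ) (s : Set ℝ) : Prop :=
  ∃ C r : ℝ≥0, 0 < r ∧ r ≤ 1 ∧ HolderOnWith C r g s

/-- A diffeomorphism of the real line with Hölder continuous derivative. -/
structure IsHolderDiffeo (φ : ℝ → ℝ) : Prop where
  bijective : Function.Bijective φ
  differentiable : Differentiable ℝ φ
  deriv_ne_zero : ∀ x, deriv φ x ≠ 0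
  holder_deriv : IsHolderOn (deriv φ) univ

/-- The derivative of `f` as a map on the interval `[a, b]` (one-sided at the end points). -/
def intervalDeriv (a b : ℝ) (f : ℝ → ℝ) (x : ℝ) : ℝ := derivWithin f (Icc a b) x

/-- The set of critical points. -/
def critSet (a b : ℝ) (f : ℝ → ℝ) : Set ℝ := {x ∈ Icc a b | intervalDeriv a b f x = 0}

/-- The Julia set: the points of `[a, b]` with no neighbourhood `V` in `[a, b]` on which the
iterates of `f` form an equicontinuous family. -/
def julia (a b : ℝ) (f : ℝ → ℝ) : Set ℝ :=
  {x ∈ Icc a b | ∀ V ∈ 𝓝[Icc a b] x, ¬ EquicontinuousOn (fun n : ℕ => f^[n]) (V ∩ Icc a b)}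

/-- The set of critical points in the Julia set. -/
def critJulia (a b : ℝ) (f : ℝ → ℝ) : Set ℝ := critSet a b f ∩ julia a b f

/-- `c` is a non-flat critical point of `f`. -/
def IsNonflat (a b : ℝ) (f : ℝ → ℝ) (c : ℝ) : Prop :=
  ∃ (ℓ : ℝ) (φ ψ : ℝ → ℝ), 1 ≤ ℓ ∧ IsHolderDiffeo φ ∧ IsHolderDiffeo ψ ∧
    φ c = 0 ∧ ψ (f c) = 0 ∧ ∀ᶠ x in 𝓝[Icc a b] c, |ψ (f x)| = |φ x| ^ ℓ

/-- The class of interval maps `f : [a, b] → [a, b]` under study. -/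
structure ClassA (a b : ℝ) (f : ℝ → ℝ) : Prop where
  mapsTo : MapsTo f (Icc a b) (Icc a b)
  not_injOn : ¬ InjOn f (Icc a b)
  differentiableOn : DifferentiableOn ℝ f (Icc a b)
  finite_critSet : (critSet a b f).Finite
  holder_deriv : IsHolderOn (intervalDeriv a b f) (Icc a b)
  nonflat : ∀ c ∈ critSet a b f, IsNonflat a b f c
  image_julia : f '' julia a b f = julia a b f
  preimage_julia : Icc a b ∩ f ⁻¹' julia a b f = julia a b f
  nontrivial_julia : (julia a b f).Nontrivial
  repelling : ∀ p ∈ julia a b f, ∀ N : ℕ, 0 < N → Function.IsPeriodicPt f N p →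
    1 < |intervalDeriv a b f^[N] p|
  exact : ∀ U : Set ℝ, IsOpen U → (U ∩ julia a b f).Nonempty →
    ∃ n : ℕ, julia a b f ⊆ f^[n] '' (U ∩ julia a b f)

/-- The restriction of `f` to its Julia set. -/
def ClassA.map {a b : ℝ} {f : ℝ → ℝ} (hf : ClassA a b f) : julia a b f → julia a b f :=
  MapsTo.restrict f (julia a b f) (julia a b f) (mapsTo_iff_image_subset.2 hf.image_julia.subset)

/-! ### Potentials -/

/-- `log |x| ∈ ℝ ∪ {-∞}`, with `log 0 = -∞`. -/
def logAbs (x : ℝ) : EReal := ENNReal.log ‖x‖ₑ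

/-- The geometric potential `log |Df|` on the Julia set. -/
def geomPotential (a b : ℝ) (f : ℝ → ℝ) (x : julia a b f) : EReal :=
  logAbs (intervalDeriv a b f x)

/-- `u(x) = g(x) + ∑_{c ∈ Crit'(f)} b(c) log |x - c|` with `g` Hölder continuous and `b ≥ 0`
(a summand with `b(c) = 0` vanishes identically). -/
def IsLogRep (a b : ℝ) (f : ℝ → ℝ) (u : julia a b f → EReal) (g : julia a b f → ℝ)
    (β : ℝ → ℝ) : Prop :=
  (∃ C r : ℝ≥0, 0 < r ∧ r ≤ 1 ∧ HolderWith C r g) ∧ (∀ c ∈ critJulia a b f, 0 ≤ β c) ∧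
    ∀ x, u x = (g x : EReal) + ∑ᶠ c ∈ critJulia a b f, (β c : EReal) * logAbs (x - c)

/-- The class of upper semi-continuous potentials `u : J(f) → ℝ ∪ {-∞}` with such a
representation. -/
def classU (a b : ℝ) (f : ℝ → ℝ) : Set (julia a b f → EReal) :=
  {u | UpperSemicontinuous u ∧ (∀ x, u x ≠ ⊤) ∧ ∃ g β, IsLogRep a b f u g β}

/-- The singular set `Λ(u)`: the points of `Crit'(f)` with positive coefficient in the
representation of `u` (the choice of the representation is immaterial, see `singularSet_eq`). -/
def singularSet (a b : ℝ) (f : ℝ → ℝ) (u : julia a b f → EReal) : Set ℝ :=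
  {c ∈ critJulia a b f | ∃ g β, IsLogRep a b f u g β ∧ 0 < β c}

/-- `S` is a `Λ`-exceptional set: a non-empty finite forward invariant subset of the Julia set with
`∅ ≠ f⁻¹(S) \ S ⊆ Λ`. -/
structure IsExceptionalSet (a b : ℝ) (f : ℝ → ℝ) (Λ S : Set ℝ) : Prop where
  nonempty : S.Nonempty
  finite : S.Finite
  subset_julia : S ⊆ julia a b f
  forward : MapsTo f S S
  nonempty_diff : ((julia a b f ∩ f ⁻¹' S) \ S).Nonempty
  diff_subset : (julia a b f ∩ f ⁻¹' S) \ S ⊆ Λ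

/-- The potential `u` is exceptional for `f`. -/
def IsExceptional (a b : ℝ) (f : ℝ → ℝ) (u : julia a b f → EReal) : Prop :=
  ∃ S, IsExceptionalSet a b f (singularSet a b f u) S

/-- The maximal exceptional set: the union of all `Crit'(f)`-exceptional sets. -/
def sigmaMax (a b : ℝ) (f : ℝ → ℝ) : Set ℝ :=
  ⋃₀ {S | IsExceptionalSet a b f (critJulia a b f) S}

/-- The function `h(x) = ∑_{ξ ∈ Σ_max} α(ξ) log |x - ξ|` on the Julia set. For `α ≤ 0` its values
are in `ℝ ∪ {+∞}`; a summand with `α(ξ) = 0` vanishes identically. -/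
def poleSum (a b : ℝ) (f : ℝ → ℝ) (α : ℝ → ℝ) (x : julia a b f) : EReal :=
  ∑ᶠ ξ ∈ sigmaMax a b f, (α ξ : EReal) * logAbs (x - ξ)

/-! ### The singular set does not depend on the representation -/

theorem logAbs_zero : logAbs 0 = ⊥ := by simp [logAbs]

theorem logAbs_eq_coe {x : ℝ} (hx : x ≠ 0) : ∃ r : ℝ, logAbs x = (r : EReal) := by
  have h1 : logAbs x ≠ ⊥ := by simp [logAbs, hx]
  have h2 : logAbs x ≠ ⊤ := by simp [logAbs]
  exact ⟨(logAbs x).toReal, (EReal.coe_toReal h2 h1).symm⟩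

theorem IsLogRep.eq_bot_iff {a b : ℝ} {f : ℝ → ℝ} {u : julia a b f → EReal} {g : julia a b f → ℝ}
    {β : ℝ → ℝ} (h : IsLogRep a b f u g β) (hfin : (critJulia a b f).Finite) (c : ℝ)
    (hc : c ∈ critJulia a b f) : u ⟨c, hc.2⟩ = ⊥ ↔ 0 < β c := by
  have key : ∀ s : Finset ℝ, c ∉ s →
      ∃ r : ℝ, ∑ d ∈ s, (β d : EReal) * logAbs (c - d) = (r : EReal) := by
    intro s hs
    induction s using Finset.induction_on with
    | empty => exact ⟨0, by simp⟩
    | insert d s hd ih =>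
      obtain ⟨r, hr⟩ := ih (fun h => hs (Finset.mem_insert_of_mem h))
      have hne : c - d ≠ 0 := fun h => hs (by
        rw [sub_eq_zero.1 h]; exact Finset.mem_insert_self _ _)
      obtain ⟨q, hq⟩ := logAbs_eq_coe hne
      refine ⟨β d * q + r, ?_⟩
      rw [Finset.sum_insert hd, hr, hq]
      push_cast
      rfl
  obtain ⟨r, hr⟩ := key (hfin.toFinset.erase c) (Finset.notMem_erase _ _)
  have hu := h.2.2 ⟨c, hc.2⟩
  rw [finsum_mem_eq_finite_toFinset_sum _ hfin,
    ← Finset.add_sum_erase _ _ (hfin.mem_toFinset.2 hc), hr] at hu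
  simp only [sub_self, logAbs_zero] at hu
  rw [hu]
  rcases (h.2.1 c hc).eq_or_lt with h0 | h0
  · rw [← h0]
    simp only [EReal.coe_zero, zero_mul, zero_add, lt_irrefl, iff_false]
    rw [← EReal.coe_add]
    exact EReal.coe_ne_bot _
  · rw [EReal.coe_mul_bot_of_pos h0]
    simp [h0]

theorem singularSet_eq {a b : ℝ} {f : ℝ → ℝ} {u : julia a b f → EReal} {g : julia a b f → ℝ}
    {β : ℝ → ℝ} (h : IsLogRep a b f u g β) (hfin : (critJulia a b f).Finite) :
    singularSet a b f u = {c ∈ critJulia a b f | 0 < β c} := by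
  ext c
  constructor
  · rintro ⟨hc, g', β', h', hpos⟩
    exact ⟨hc, (h.eq_bot_iff hfin c hc).1 ((h'.eq_bot_iff hfin c hc).2 hpos)⟩
  · rintro ⟨hc, hpos⟩
    exact ⟨hc, g, β, h, hpos⟩

end

/-! At each `x ∈ J` the map has a local order `ℓ x ≥ 1`: up to Hölder terms, `log |f y - f x|` is `ℓ
x * log |y - x|` and `log |Df y|` is `(ℓ x - 1) * log |y - x|`, with `ℓ x > 1` exactly on `Crit'`
(`ClassA.exists_order`). Put `β = 1 + α`. The coefficient of `log |y - x|` in `log |Df| + h ∘ f - h`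
is then `m x = ℓ x * β (f x) - β x`, and the problem becomes combinatorial: find `β` with values in
`(0, 1]`, equal to `1` off `Σ_max`, such that `m ≥ 0`, `m = 0` off `Crit'`, and no non-empty finite
forward invariant `S` has `f⁻¹(S) \ S ⊆ {m > 0}`.

The product `L x` of the orders along the forward orbit satisfies `L x = ℓ x * L (f x)`, since no
critical point in `J` is periodic. So `L * γ` gives `m = 0` whenever `γ` is constant along orbits.
On `Σ_max` take `β = min 1 (L * γ)`, where `γ` is the largest `1 / L y` over the points `y ∈
f⁻¹(Σ_max) \ Σ_max` whose orbit meets that of the given point. Then `m ≥ 0`, and the orbit of a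
maximizing `y` enters any bad `S` through a point where `m ≤ 0` (`ClassA.exists_weight`). Taking `S
= Σ_max` gives the proper inclusion.

`Σ_max` is finite because topological exactness bounds the size of exceptional sets
(`ClassA.exists_ncard_exceptional_le`). Once the logarithms cancel, the remainder is Hölder by
compactness (`exists_holder_extension`). The pressures agree because a non-atomic measure ignores
the finitely many poles and a coboundary has zero mean even when `h` is not integrable
(`MeasurePreserving.integral_coboundary`). -/

/-! ### Integrals of coboundaries -/

section Coboundary

variable {X : Type*} [MeasurableSpace X]

/-- The upper bound makes the positive part integrable, so integrability can fail only through the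
negative part, and the value is then `⊥`. -/
theorem extIntegral_eq_of_ae_eq_coe {μ : Measure X} [IsFiniteMeasure μ] {φ : X → EReal}
    {u : X → ℝ} {M : ℝ} (hu : Measurable u) (h : ∀ᵐ x ∂μ, φ x = (u x : EReal))
    (hM : ∀ᵐ x ∂μ, u x ≤ M) [Decidable (Integrable u μ)] :
    extIntegral μ φ = if Integrable u μ then ((∫ x, u x ∂μ : ℝ) : EReal) else ⊥ := by
  have h1 : ∫⁻ x, (φ x).toENNReal ∂μ = ∫⁻ x, ENNReal.ofReal (u x) ∂μ :=
    lintegral_congr_ae (h.mono fun x hx => by simp [hx])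
  have h2 : ∫⁻ x, (-φ x).toENNReal ∂μ = ∫⁻ x, ENNReal.ofReal (-u x) ∂μ :=
    lintegral_congr_ae (h.mono fun x hx => by
      simp only [hx, ← EReal.coe_neg, EReal.real_coe_toENNReal])
  have hfin : ∫⁻ x, ENNReal.ofReal (u x) ∂μ < ⊤ := by
    calc ∫⁻ x, ENNReal.ofReal (u x) ∂μ ≤ ∫⁻ _, ENNReal.ofReal M ∂μ :=
          lintegral_mono_ae (hM.mono fun x hx => ENNReal.ofReal_le_ofReal hx)
      _ < ⊤ := by
          rw [lintegral_const]
          exact ENNReal.mul_lt_top ENNReal.ofReal_lt_top (measure_lt_top _ _)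
  rw [extIntegral, h1, h2]
  split_ifs with hi
  · rw [integral_eq_lintegral_pos_part_sub_lintegral_neg_part hi, EReal.coe_sub,
      EReal.coe_ennreal_toReal hfin.ne,
      EReal.coe_ennreal_toReal (show ∫⁻ x, ENNReal.ofReal (-u x) ∂μ ≠ ⊤ from
        hi.neg.lintegral_lt_top.ne)]
  · have htop : ∫⁻ x, ENNReal.ofReal (-u x) ∂μ = ⊤ := by
      by_contra hne
      refine hi ⟨hu.aestronglyMeasurable, ?_⟩
      rw [hasFiniteIntegral_iff_enorm]
      calc ∫⁻ x, ‖u x‖ₑ ∂μ ≤ ∫⁻ x, (ENNReal.ofReal (u x) + ENNReal.ofReal (-u x)) ∂μ := by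
            refine lintegral_mono fun x => ?_
            rw [← ofReal_norm, Real.norm_eq_abs]
            rcases le_total 0 (u x) with h0 | h0
            · rw [abs_of_nonneg h0]; exact le_self_add
            · rw [abs_of_nonpos h0]; exact le_add_self
        _ = ∫⁻ x, ENNReal.ofReal (u x) ∂μ + ∫⁻ x, ENNReal.ofReal (-u x) ∂μ :=
            lintegral_add_left hu.ennreal_ofReal _
        _ < ⊤ := ENNReal.add_lt_top.2 ⟨hfin, lt_top_iff_ne_top.2 hne⟩
    rw [htop, EReal.coe_ennreal_top]
    lift ∫⁻ x, ENNReal.ofReal (u x) ∂μ to ℝ≥0 using hfin.ne with r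
    exact EReal.sub_top _

/-- A coboundary whose negative part is integrable is integrable and has zero mean. -/
theorem MeasureTheory.MeasurePreserving.integral_coboundary {μ : Measure X} [IsFiniteMeasure μ]
    {T : X → X} (hT : MeasurePreserving T μ μ) {H k : X → ℝ} (hH : Measurable H)
    (hk : Integrable k μ) (hle : ∀ᵐ x ∂μ, k x ≤ H (T x) - H x) :
    Integrable (fun x => H (T x) - H x) μ ∧ ∫ x, (H (T x) - H x) ∂μ = 0 := by
  -- Truncation at height `n`. The truncated `H` is bounded, so its coboundary has zero mean by
  -- invariance. As `c n` is monotone and 1-Lipschitz, that coboundary is a.e. at least `-|k|` and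
  -- is dominated by `|H ∘ T - H|`.
  let c : ℕ → ℝ → ℝ := fun n y => max (-n) (min y n)
  have hcm : ∀ n, Measurable fun x => c n (H x) := fun n =>
    measurable_const.max (hH.min measurable_const)
  have hci : ∀ n, Integrable (fun x => c n (H x)) μ := fun n =>
    Integrable.of_bound (hcm n).aestronglyMeasurable n (Eventually.of_forall fun x => by
      have : (0 : ℝ) ≤ n := n.cast_nonneg
      rw [Real.norm_eq_abs, abs_le]
      exact ⟨le_max_left _ _, max_le (by linarith) (min_le_right _ _)⟩)
  have hciT : ∀ n, Integrable (fun x => c n (H (T x))) μ := fun n =>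
    hT.integrable_comp_of_integrable (hci n)
  have hint : ∀ n, ∫ x, (c n (H (T x)) - c n (H x)) ∂μ = 0 := by
    intro n
    rw [integral_sub (hciT n) (hci n), sub_eq_zero]
    conv_rhs => rw [← hT.map_eq]
    rw [integral_map hT.measurable.aemeasurable (by
      rw [hT.map_eq]; exact (hcm n).aestronglyMeasurable)]
  have hclip : ∀ n y z, |c n y - c n z| ≤ |y - z| := fun n y z => by
    have h1 := abs_max_sub_max_le_max (-n : ℝ) (min y n) (-n) (min z n)
    have h2 := abs_min_sub_min_le_max y (n : ℝ) z n
    simp only [sub_self, abs_zero, abs_nonneg, sup_of_le_left, sup_of_le_right] at h1 h2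
    exact h1.trans h2
  have hcmono : ∀ n, Monotone (c n) := fun n y z h =>
    max_le_max le_rfl (min_le_min h le_rfl)
  have hlow : ∀ n, ∀ᵐ x ∂μ, -|k x| ≤ c n (H (T x)) - c n (H x) := by
    intro n
    filter_upwards [hle] with x hx
    rcases le_total (H x) (H (T x)) with h | h
    · linarith [hcmono n h, abs_nonneg (k x)]
    · have h1 := neg_le_of_abs_le (hclip n (H (T x)) (H x))
      rw [abs_of_nonpos (by linarith : H (T x) - H x ≤ 0)] at h1
      linarith [neg_abs_le (k x)]
  have hclim : ∀ y, Tendsto (fun n => c n y) atTop (𝓝 y) := by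
    intro y
    refine tendsto_const_nhds.congr' ?_
    filter_upwards [eventually_ge_atTop ⌈|y|⌉₊] with n hn
    have h1 : |y| ≤ n := (Nat.le_ceil _).trans (by exact_mod_cast hn)
    have h2 := abs_le.1 h1
    simp only [c]
    rw [min_eq_left h2.2, max_eq_right h2.1]
  have hm : Measurable fun x => H (T x) - H x := (hH.comp hT.measurable).sub hH
  have hbound : ∀ n, ∫⁻ x, ENNReal.ofReal (c n (H (T x)) - c n (H x) + |k x|) ∂μ =
      ENNReal.ofReal (∫ x, |k x| ∂μ) := by
    intro n
    have h1 : Integrable (fun x => c n (H (T x)) - c n (H x)) μ := (hciT n).sub (hci n)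
    have h2 : Integrable (fun x => c n (H (T x)) - c n (H x) + |k x|) μ := h1.add hk.abs
    rw [← ofReal_integral_eq_lintegral_ofReal h2
      ((hlow n).mono fun x hx => by simp only [Pi.zero_apply]; linarith),
      integral_add h1 hk.abs, hint n, zero_add]
  -- After adding `|k|` the truncated coboundaries are nonnegative with an integral independent of
  -- `n`. Fatou yields integrability of the limit, and dominated convergence can then be used for
  -- the mean.
  have hfatou : ∫⁻ x, ENNReal.ofReal (H (T x) - H x + |k x|) ∂μ ≤
      ENNReal.ofReal (∫ x, |k x| ∂μ) := by
    calc ∫⁻ x, ENNReal.ofReal (H (T x) - H x + |k x|) ∂μ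
        = ∫⁻ x, liminf (fun n => ENNReal.ofReal (c n (H (T x)) - c n (H x) + |k x|)) atTop ∂μ := by
          refine lintegral_congr fun x => (Tendsto.liminf_eq ?_).symm
          exact ENNReal.tendsto_ofReal (((hclim _).sub (hclim _)).add_const _)
      _ ≤ liminf (fun n => ∫⁻ x, ENNReal.ofReal (c n (H (T x)) - c n (H x) + |k x|) ∂μ) atTop :=
          lintegral_liminf_le' fun n =>
            (((hcm n).comp hT.measurable).sub (hcm n)).aemeasurable.add
              hk.abs.aemeasurable |>.ennreal_ofReal
      _ = ENNReal.ofReal (∫ x, |k x| ∂μ) := by simp only [hbound, liminf_const]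
  have hI : Integrable (fun x => H (T x) - H x + |k x|) μ := by
    refine ⟨hm.aestronglyMeasurable.add hk.abs.aestronglyMeasurable, ?_⟩
    rw [hasFiniteIntegral_iff_ofReal (hle.mono fun x hx => by
      simp only [Pi.zero_apply]; linarith [neg_abs_le (k x)])]
    exact hfatou.trans_lt ENNReal.ofReal_lt_top
  have hI' : Integrable (fun x => H (T x) - H x) μ := by
    refine (hI.sub hk.abs).congr (Eventually.of_forall fun x => ?_)
    simp
  refine ⟨hI', ?_⟩
  have hlim := tendsto_integral_of_dominated_convergence (fun x => |H (T x) - H x|)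
    (fun n => (((hcm n).comp hT.measurable).sub (hcm n)).aestronglyMeasurable (μ := μ)) hI'.abs
    (fun n => Eventually.of_forall fun x => hclip n (H (T x)) (H x))
    (Eventually.of_forall fun x => (hclim (H (T x))).sub (hclim (H x)))
  refine tendsto_nhds_unique hlim ?_
  exact tendsto_const_nhds.congr fun n => (hint n).symm

/-- Two potentials that are bounded above and differ almost everywhere by a finite coboundary have
the same integral. -/
theorem extIntegral_eq_of_coboundary {μ : Measure X} [IsFiniteMeasure μ] {T : X → X}
    (hT : MeasurePreserving T μ μ) {φ ψ : X → EReal} {u v H : X → ℝ} {M : ℝ} (hu : Measurable u)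
    (hv : Measurable v) (hH : Measurable H) (hφ : ∀ᵐ x ∂μ, φ x = (u x : EReal))
    (hψ : ∀ᵐ x ∂μ, ψ x = (v x : EReal)) (huM : ∀ᵐ x ∂μ, u x ≤ M) (hvM : ∀ᵐ x ∂μ, v x ≤ M)
    (huv : ∀ᵐ x ∂μ, u x = v x + H (T x) - H x) : extIntegral μ φ = extIntegral μ ψ := by
  classical
  rw [extIntegral_eq_of_ae_eq_coe hu hφ huM, extIntegral_eq_of_ae_eq_coe hv hψ hvM]
  -- Since `v ≤ M`, the coboundary `u - v` is bounded below by the integrable function `u - M`. The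
  -- converse direction swaps `u` and `v` and replaces `H` by `-H`.
  have key : ∀ {u v H : X → ℝ}, Measurable H → (∀ᵐ x ∂μ, v x ≤ M) →
      (∀ᵐ x ∂μ, u x = v x + H (T x) - H x) → Integrable u μ →
      Integrable v μ ∧ ∫ x, u x ∂μ = ∫ x, v x ∂μ := by
    intro u v H hH hvM huv hi
    obtain ⟨h1, h2⟩ := hT.integral_coboundary hH (hi.sub (integrable_const M)) (by
      filter_upwards [hvM, huv] with x hx hx'
      simp only [Pi.sub_apply]
      linarith)
    have h3 : v =ᵐ[μ] fun x => u x - (H (T x) - H x) := by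
      filter_upwards [huv] with x hx
      linarith
    refine ⟨(hi.sub h1).congr h3.symm, ?_⟩
    rw [integral_congr_ae h3, integral_sub hi h1, h2, sub_zero]
  by_cases hiu : Integrable u μ
  · obtain ⟨h1, h2⟩ := key hH hvM huv hiu
    rw [if_pos hiu, if_pos h1, h2]
  · have hiv : ¬ Integrable v μ := fun hiv => hiu
      (key (H := fun x => -H x) hH.neg huM (huv.mono fun x hx => by linarith) hiv).1
    rw [if_neg hiu, if_neg hiv]

end Coboundary

/-! ### Local Hölder continuity and logarithmic singularities -/

/-- `k` is Hölder continuous on a neighbourhood of `x₀` in `s`. -/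
def HolderAt (s : Set ℝ) (k : ℝ → ℝ) (x₀ : ℝ) : Prop :=
  ∃ C r δ : ℝ, 0 ≤ C ∧ 0 < r ∧ r ≤ 1 ∧ 0 < δ ∧ δ ≤ 1 / 2 ∧
    ∀ x ∈ s, ∀ y ∈ s, |x - x₀| < δ → |y - x₀| < δ → |k x - k y| ≤ C * |x - y| ^ r

/-- Near `x₀` in `s`, `u` is the sum of `β log |x - x₀|` and a Hölder continuous function. -/
def LogSing (s : Set ℝ) (u : ℝ → ℝ) (x₀ β : ℝ) : Prop :=
  ∃ k, HolderAt s k x₀ ∧ ∀ᶠ x in 𝓝[s \ {x₀}] x₀, u x = β * Real.log (x - x₀) + k x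

theorem IsHolderOn.exists_le {g : ℝ → ℝ} {s : Set ℝ} (h : IsHolderOn g s) :
    ∃ C r : ℝ, 0 ≤ C ∧ 0 < r ∧ r ≤ 1 ∧ ∀ x ∈ s, ∀ y ∈ s, |g x - g y| ≤ C * |x - y| ^ r := by
  obtain ⟨C, r, hr0, hr1, h⟩ := h
  refine ⟨C, r, C.2, hr0, hr1, fun x hx y hy => ?_⟩
  have h1 := h x hx y hy
  rw [edist_nndist, edist_nndist, ← ENNReal.coe_rpow_of_nonneg _ r.coe_nonneg, ← ENNReal.coe_mul,
    ENNReal.coe_le_coe] at h1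
  have h2 : (nndist (g x) (g y) : ℝ) ≤ C * (nndist x y : ℝ) ^ (r : ℝ) := by exact_mod_cast h1
  simpa [Real.dist_eq] using h2

theorem holderWith_of_le {X : Type*} [PseudoMetricSpace X] {g : X → ℝ} {C r : ℝ} (hC : 0 ≤ C)
    (hr : 0 ≤ r) (h : ∀ x y, |g x - g y| ≤ C * dist x y ^ r) :
    HolderWith C.toNNReal r.toNNReal g := by
  intro x y
  rw [edist_nndist, edist_nndist, ← ENNReal.coe_rpow_of_nonneg _ r.toNNReal.coe_nonneg, ← ENNReal.coe_mul,
    ENNReal.coe_le_coe, ← NNReal.coe_le_coe]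
  push_cast
  rw [Real.coe_toNNReal _ hC, Real.coe_toNNReal _ hr, Real.dist_eq]
  exact h x y

/-- The purpose of `δ ≤ 1 / 2` in `HolderAt`: at distances at most `1` a Hölder exponent may be
lowered, so different exponents can be made equal. -/
theorem abs_sub_le_one_of_near {x y x₀ δ : ℝ} (hδ : δ ≤ 1 / 2) (hx : |x - x₀| < δ)
    (hy : |y - x₀| < δ) : |x - y| ≤ 1 := by
  rw [abs_lt] at hx hy
  rw [abs_le]
  constructor <;> linarith

theorem holderAt_of_le {s : Set ℝ} {k : ℝ → ℝ} {x₀ C r δ : ℝ} (hr : 0 < r) (hδ : 0 < δ)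
    (h : ∀ x ∈ s, ∀ y ∈ s, |x - x₀| < δ → |y - x₀| < δ → |k x - k y| ≤ C * |x - y| ^ r) :
    HolderAt s k x₀ := by
  refine ⟨|C|, min r 1, min δ (1 / 2), abs_nonneg _, lt_min hr one_pos, min_le_right _ _,
    lt_min hδ (by norm_num), min_le_right _ _, fun x hx y hy hx' hy' => ?_⟩
  have h1 := abs_sub_le_one_of_near (min_le_right _ _) hx' hy'
  calc |k x - k y| ≤ C * |x - y| ^ r :=
        h x hx y hy (hx'.trans_le (min_le_left _ _)) (hy'.trans_le (min_le_left _ _))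
    _ ≤ |C| * |x - y| ^ r := by gcongr; exact le_abs_self C
    _ ≤ |C| * |x - y| ^ min r 1 := by
        refine mul_le_mul_of_nonneg_left ?_ (abs_nonneg _)
        exact Real.rpow_le_rpow_of_exponent_ge' (abs_nonneg _) h1 (by positivity) (min_le_left _ _)

theorem HolderAt.of_abs_le {s : Set ℝ} {k k' : ℝ → ℝ} {x₀ A δ : ℝ} (h : HolderAt s k x₀)
    (hδ : 0 < δ) (hle : ∀ x ∈ s, ∀ y ∈ s, |x - x₀| < δ → |y - x₀| < δ →
      |k' x - k' y| ≤ A * |k x - k y|) : HolderAt s k' x₀ := by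
  obtain ⟨C, r, δ', hC, hr, -, hδ', -, h⟩ := h
  refine holderAt_of_le (C := |A| * C) hr (lt_min hδ hδ') fun x hx y hy hx' hy' => ?_
  rw [lt_min_iff] at hx' hy'
  calc |k' x - k' y| ≤ A * |k x - k y| := hle x hx y hy hx'.1 hy'.1
    _ ≤ |A| * |k x - k y| := by gcongr; exact le_abs_self A
    _ ≤ |A| * (C * |x - y| ^ r) := by gcongr; exact h x hx y hy hx'.2 hy'.2
    _ = |A| * C * |x - y| ^ r := by ring

theorem IsHolderOn.holderAt {g : ℝ → ℝ} {s : Set ℝ} (h : IsHolderOn g s) (x₀ : ℝ) :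
    HolderAt s g x₀ := by
  obtain ⟨C, r, -, hr, -, h⟩ := h.exists_le
  exact holderAt_of_le hr one_pos fun x hx y hy _ _ => h x hx y hy

theorem HolderAt.const_mul {s : Set ℝ} {k : ℝ → ℝ} {x₀ : ℝ} (h : HolderAt s k x₀) (A : ℝ) :
    HolderAt s (fun x => A * k x) x₀ :=
  h.of_abs_le (A := |A|) one_pos fun x _ y _ _ _ => by rw [← mul_sub, abs_mul]

theorem HolderAt.add {s : Set ℝ} {k k' : ℝ → ℝ} {x₀ : ℝ} (h : HolderAt s k x₀)
    (h' : HolderAt s k' x₀) : HolderAt s (fun x => k x + k' x) x₀ := by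
  obtain ⟨C, r, δ, hC, hr, hr1, hδ, hδ1, h⟩ := h
  obtain ⟨C', r', δ', hC', hr', hr1', hδ', hδ1', h'⟩ := h'
  refine holderAt_of_le (C := C + C') (lt_min hr hr') (lt_min hδ hδ')
    fun x hx y hy hx' hy' => ?_
  have h1 := abs_sub_le_one_of_near ((min_le_left _ _).trans hδ1) hx' hy'
  rw [lt_min_iff] at hx' hy'
  calc |k x + k' x - (k y + k' y)| = |(k x - k y) + (k' x - k' y)| := by ring_nf
    _ ≤ |k x - k y| + |k' x - k' y| := abs_add_le _ _
    _ ≤ C * |x - y| ^ r + C' * |x - y| ^ r' :=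
        add_le_add (h x hx y hy hx'.1 hy'.1) (h' x hx y hy hx'.2 hy'.2)
    _ ≤ C * |x - y| ^ min r r' + C' * |x - y| ^ min r r' := by
        refine add_le_add (mul_le_mul_of_nonneg_left ?_ hC) (mul_le_mul_of_nonneg_left ?_ hC')
        · exact Real.rpow_le_rpow_of_exponent_ge' (abs_nonneg _) h1 (lt_min hr hr').le
            (min_le_left _ _)
        · exact Real.rpow_le_rpow_of_exponent_ge' (abs_nonneg _) h1 (lt_min hr hr').le
            (min_le_right _ _)
    _ = (C + C') * |x - y| ^ min r r' := by ring

theorem holderAt_const (s : Set ℝ) (A x₀ : ℝ) : HolderAt s (fun _ => A) x₀ :=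
  holderAt_of_le (C := 0) one_pos one_pos fun x _ y _ _ _ => by simp

theorem holderAt_id (s : Set ℝ) (x₀ : ℝ) : HolderAt s (fun x => x) x₀ :=
  holderAt_of_le (C := 1) one_pos one_pos fun x _ y _ _ _ => by simp

theorem HolderAt.continuousWithinAt {s : Set ℝ} {k : ℝ → ℝ} {x₀ : ℝ} (h : HolderAt s k x₀) :
    ∃ δ > 0, ∀ x ∈ s, |x - x₀| < δ → ContinuousWithinAt k s x := by
  obtain ⟨C, r, δ, hC, hr, -, hδ, -, h⟩ := h
  refine ⟨δ, hδ, fun x hx hx' => ?_⟩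
  have h0 : Tendsto (fun y => C * |y - x| ^ r) (𝓝[s] x) (𝓝 0) := by
    have : ContinuousAt (fun y => C * |y - x| ^ r) x := by
      refine continuousAt_const.mul (ContinuousAt.rpow_const (by fun_prop) (Or.inr hr.le))
    have h2 := this.tendsto
    simp only [sub_self, abs_zero, Real.zero_rpow hr.ne', mul_zero] at h2
    exact h2.mono_left nhdsWithin_le_nhds
  rw [ContinuousWithinAt, tendsto_iff_dist_tendsto_zero]
  refine squeeze_zero' (Eventually.of_forall fun _ => dist_nonneg) ?_ h0
  have hopen : ∀ᶠ y in 𝓝[s] x, |y - x₀| < δ :=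
    nhdsWithin_le_nhds ((isOpen_lt (by fun_prop) continuous_const).mem_nhds hx')
  filter_upwards [hopen, self_mem_nhdsWithin] with y hy hys
  rw [Real.dist_eq]
  exact h y hys x hx hy hx'

/-- Follows from `log t ≤ t - 1` at `t = |u / v|`. Opposite signs are harmless because `Real.log`
depends only on the absolute value. -/
theorem abs_log_sub_log_le {m u v : ℝ} (hm : 0 < m) (hu : m ≤ |u|) (hv : m ≤ |v|) :
    |Real.log u - Real.log v| ≤ m⁻¹ * |u - v| := by
  have key : ∀ {u v : ℝ}, m ≤ |u| → m ≤ |v| → Real.log u - Real.log v ≤ m⁻¹ * |u - v| := by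
    intro u v hu hv
    have hu0 : u ≠ 0 := abs_pos.1 (hm.trans_le hu)
    have hv0 : v ≠ 0 := abs_pos.1 (hm.trans_le hv)
    have hv1 : 0 < |v| := abs_pos.2 hv0
    rw [← Real.log_div hu0 hv0, ← Real.log_abs]
    calc Real.log |u / v| ≤ |u / v| - 1 :=
          Real.log_le_sub_one_of_pos (abs_pos.2 (div_ne_zero hu0 hv0))
      _ = |v|⁻¹ * (|u| - |v|) := by rw [abs_div]; field_simp
      _ ≤ |v|⁻¹ * |u - v| := by gcongr; exact abs_sub_abs_le_abs_sub u v
      _ ≤ m⁻¹ * |u - v| := by gcongr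
  rw [abs_le]
  constructor
  · have := key hv hu
    rw [abs_sub_comm] at this
    linarith
  · exact key hu hv

theorem HolderAt.log {s : Set ℝ} {k : ℝ → ℝ} {x₀ : ℝ} (h : HolderAt s k x₀) (hx₀ : x₀ ∈ s)
    (h0 : k x₀ ≠ 0) : HolderAt s (fun x => Real.log (k x)) x₀ := by
  obtain ⟨δ, hδ, hc⟩ := h.continuousWithinAt
  have h1 : ContinuousWithinAt (fun x => |k x|) s x₀ := (hc x₀ hx₀ (by simpa using hδ)).abs
  have h2 : ∀ᶠ x in 𝓝[s] x₀, |k x₀| / 2 < |k x| :=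
    h1.eventually (lt_mem_nhds (by linarith [abs_pos.2 h0]))
  obtain ⟨ε, hε, h3⟩ := Metric.mem_nhdsWithin_iff.1 h2
  refine h.of_abs_le (A := (|k x₀| / 2)⁻¹) hε fun x hx y hy hx' hy' => ?_
  exact abs_log_sub_log_le (by have := abs_pos.2 h0; positivity) (h3 ⟨hx', hx⟩).le (h3 ⟨hy', hy⟩).le

theorem HolderAt.comp_lipschitz {s t : Set ℝ} {k F : ℝ → ℝ} {x₀ K : ℝ} (h : HolderAt t k (F x₀))
    (hF : MapsTo F s t) (hx₀ : x₀ ∈ s) (hK : ∀ x ∈ s, ∀ y ∈ s, |F x - F y| ≤ K * |x - y|) :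
    HolderAt s (fun x => k (F x)) x₀ := by
  obtain ⟨C, r, δ, hC, hr, -, hδ, -, h⟩ := h
  have hK' : ∀ x ∈ s, ∀ y ∈ s, |F x - F y| ≤ (|K| + 1) * |x - y| := fun x hx y hy =>
    (hK x hx y hy).trans (by gcongr; linarith [le_abs_self K])
  have hpos : 0 < |K| + 1 := by positivity
  have hnear : ∀ x ∈ s, |x - x₀| < δ / (|K| + 1) → |F x - F x₀| < δ := fun x hx hx' =>
    (hK' x hx x₀ hx₀).trans_lt (by rwa [lt_div_iff₀' hpos] at hx')
  refine holderAt_of_le (C := C * (|K| + 1) ^ r) hr (div_pos hδ hpos) fun x hx y hy hx' hy' => ?_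
  calc |k (F x) - k (F y)| ≤ C * |F x - F y| ^ r :=
        h _ (hF hx) _ (hF hy) (hnear x hx hx') (hnear y hy hy')
    _ ≤ C * ((|K| + 1) * |x - y|) ^ r := by gcongr; exact hK' x hx y hy
    _ = C * (|K| + 1) ^ r * |x - y| ^ r := by
        rw [Real.mul_rpow hpos.le (abs_nonneg _), mul_assoc]

theorem HolderAt.logSing {s : Set ℝ} {k : ℝ → ℝ} {x₀ : ℝ} (h : HolderAt s k x₀) :
    LogSing s k x₀ 0 :=
  ⟨k, h, Eventually.of_forall fun x => by ring⟩

namespace LogSing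

variable {s : Set ℝ} {u v : ℝ → ℝ} {x₀ β β' : ℝ}

theorem congr (h : LogSing s u x₀ β) (huv : ∀ᶠ x in 𝓝[s \ {x₀}] x₀, v x = u x) :
    LogSing s v x₀ β := by
  obtain ⟨k, hk, h⟩ := h
  exact ⟨k, hk, by filter_upwards [h, huv] with x hx hx'; rw [hx', hx]⟩

theorem add (h : LogSing s u x₀ β) (h' : LogSing s v x₀ β') :
    LogSing s (fun x => u x + v x) x₀ (β + β') := by
  obtain ⟨k, hk, h⟩ := h
  obtain ⟨k', hk', h'⟩ := h'
  exact ⟨_, hk.add hk', by filter_upwards [h, h'] with x hx hx'; rw [hx, hx']; ring⟩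

theorem const_mul (h : LogSing s u x₀ β) (A : ℝ) : LogSing s (fun x => A * u x) x₀ (A * β) := by
  obtain ⟨k, hk, h⟩ := h
  exact ⟨_, hk.const_mul A, by filter_upwards [h] with x hx; rw [hx]; ring⟩

theorem sum {ι : Type*} (t : Finset ι) {u : ι → ℝ → ℝ} {β : ι → ℝ}
    (h : ∀ i ∈ t, LogSing s (u i) x₀ (β i)) :
    LogSing s (fun x => ∑ i ∈ t, u i x) x₀ (∑ i ∈ t, β i) := by
  classical
  induction t using Finset.induction_on with
  | empty => simpa using (holderAt_const s 0 x₀).logSing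
  | insert i t hi ih =>
    simp only [Finset.sum_insert hi]
    exact (h i (Finset.mem_insert_self _ _)).add
      (ih fun j hj => h j (Finset.mem_insert_of_mem hj))

end LogSing

theorem logSing_log_sub {s : Set ℝ} {x₀ : ℝ} (hx₀ : x₀ ∈ s) (y : ℝ) :
    LogSing s (fun x => Real.log (x - y)) x₀ (if x₀ = y then 1 else 0) := by
  split_ifs with h
  · subst h
    exact ⟨_, holderAt_const s 0 _, Eventually.of_forall fun x => by ring⟩
  · refine HolderAt.logSing (HolderAt.log ?_ hx₀ (sub_ne_zero.2 h))
    simpa only [sub_eq_add_neg] using (holderAt_id s x₀).add (holderAt_const s (-y) x₀)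

/-! ### Difference quotients and removable logarithmic singularities. -/

/-- Difference quotients of a function with Hölder continuous derivative are Hölder continuous. -/
theorem exists_holder_quotient {A B : ℝ} {F F' : ℝ → ℝ}
    (hF : ∀ x ∈ Icc A B, HasDerivWithinAt F (F' x) (Icc A B) x) (hF' : IsHolderOn F' (Icc A B))
    {x₀ : ℝ} (hx₀ : x₀ ∈ Icc A B) :
    ∃ q, HolderAt (Icc A B) q x₀ ∧ q x₀ = F' x₀ ∧ ∀ x, F x - F x₀ = (x - x₀) * q x := by
  obtain ⟨C, r, hC, hr, -, hH⟩ := hF'.exists_le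
  let q : ℝ → ℝ := fun x => if x = x₀ then F' x₀ else (F x - F x₀) / (x - x₀)
  have hseg : ∀ x ∈ Icc A B, ∀ t ∈ Icc (0 : ℝ) 1, x₀ + t * (x - x₀) ∈ Icc A B := by
    intro x hx t ht
    have := (convex_Icc A B).add_smul_sub_mem hx₀ hx ht
    simpa using this
  -- The quotient is the mean of `F'` over the segment from `x₀` to `x`. A primitive `P` on `[0, 1]`
  -- with increment `q x` replaces the integral, so that the mean value inequality bounds `q x - q
  -- y`.
  have hP : ∀ x ∈ Icc A B, ∃ P : ℝ → ℝ,
      (∀ t ∈ Icc (0 : ℝ) 1, HasDerivWithinAt P (F' (x₀ + t * (x - x₀))) (Icc 0 1) t) ∧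
      P 1 - P 0 = q x := by
    intro x hx
    by_cases h : x = x₀
    · refine ⟨fun t => t * F' x₀, fun t _ => ?_, by simp [q, h]⟩
      simpa [h] using ((hasDerivAt_id t).mul_const (F' x₀)).hasDerivWithinAt
    · have hne : x - x₀ ≠ 0 := sub_ne_zero.2 h
      refine ⟨fun t => F (x₀ + t * (x - x₀)) / (x - x₀), fun t ht => ?_, ?_⟩
      · have h1 : HasDerivWithinAt (fun t : ℝ => x₀ + t * (x - x₀)) (x - x₀) (Icc 0 1) t := by
          simpa using (((hasDerivAt_id t).mul_const (x - x₀)).const_add x₀).hasDerivWithinAt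
        have h2 := ((hF _ (hseg x hx t ht)).comp t h1 (fun s hs => hseg x hx s hs)).div_const
          (x - x₀)
        rwa [mul_div_cancel_right₀ _ hne] at h2
      · simp [q, h, sub_div]
  refine ⟨q, holderAt_of_le (C := C) hr one_pos fun x hx y hy _ _ => ?_, by simp [q], fun x => ?_⟩
  · obtain ⟨P, hP1, hP2⟩ := hP x hx
    obtain ⟨Q, hQ1, hQ2⟩ := hP y hy
    have h1 := (convex_Icc (0 : ℝ) 1).norm_image_sub_le_of_norm_hasDerivWithin_le
      (f := fun t => P t - Q t) (C := C * |x - y| ^ r)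
      (fun t ht => (hP1 t ht).sub (hQ1 t ht)) (fun t ht => ?_) (left_mem_Icc.2 zero_le_one)
      (right_mem_Icc.2 zero_le_one)
    · rw [sub_zero, norm_one, mul_one, Real.norm_eq_abs] at h1
      rw [← hP2, ← hQ2]
      convert h1 using 2
      ring
    · rw [Real.norm_eq_abs]
      refine (hH _ (hseg x hx t ht) _ (hseg y hy t ht)).trans ?_
      refine mul_le_mul_of_nonneg_left (Real.rpow_le_rpow (abs_nonneg _) ?_ hr.le) hC
      rw [show x₀ + t * (x - x₀) - (x₀ + t * (y - x₀)) = t * (x - y) by ring, abs_mul,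
        abs_of_nonneg ht.1]
      exact mul_le_of_le_one_left (abs_nonneg _) ht.2
  · by_cases h : x = x₀
    · simp [h]
    · simp only [q, if_neg h]
      rw [mul_div_cancel₀ _ (sub_ne_zero.2 h)]

/-- In `F x - F x₀ = (x - x₀) * q x` the factor `q` is Hölder with `q x₀ = F' x₀ ≠ 0`, so `log q` is
Hölder near `x₀`. -/
theorem logSing_log_sub_of_deriv_ne_zero {A B : ℝ} {F F' : ℝ → ℝ}
    (hF : ∀ x ∈ Icc A B, HasDerivWithinAt F (F' x) (Icc A B) x) (hF' : IsHolderOn F' (Icc A B))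
    {x₀ : ℝ} (hx₀ : x₀ ∈ Icc A B) (h0 : F' x₀ ≠ 0) :
    LogSing (Icc A B) (fun x => Real.log (F x - F x₀)) x₀ 1 := by
  obtain ⟨q, hq, hq0, hqx⟩ := exists_holder_quotient hF hF' hx₀
  obtain ⟨δ, hδ, hc⟩ := hq.continuousWithinAt
  refine ⟨_, hq.log hx₀ (by rwa [hq0]), ?_⟩
  have h1 : ∀ᶠ x in 𝓝[Icc A B] x₀, q x ≠ 0 :=
    (hc x₀ hx₀ (by simpa using hδ)).eventually_ne (by rwa [hq0])
  filter_upwards [nhdsWithin_mono _ sdiff_subset h1, self_mem_nhdsWithin] with x hx hx'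
  rw [hqx, Real.log_mul (sub_ne_zero.2 hx'.2) hx, one_mul]

theorem neBot_nhdsWithin_Icc_diff {A B x : ℝ} (hAB : A < B) (hx : x ∈ Icc A B) :
    (𝓝[Icc A B \ {x}] x).NeBot := by
  have h1 := (isPreconnected_Icc (a := A) (b := B)).preperfect_of_nontrivial
    ⟨A, left_mem_Icc.2 hAB.le, B, right_mem_Icc.2 hAB.le, hAB.ne⟩ x hx
  rwa [accPt_principal_iff_nhdsWithin] at h1

/-- A function whose singularities on a compact set are removable agrees, up to values at points,
with a Hölder continuous function. -/
theorem exists_holder_extension {A B : ℝ} (hAB : A < B) {J : Set ℝ} (hJ : IsCompact J)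
    (hJI : J ⊆ Icc A B) {W : ℝ → ℝ} (hW : ∀ x ∈ J, LogSing (Icc A B) W x 0) :
    ∃ g : J → ℝ, (∃ C r : ℝ≥0, 0 < r ∧ r ≤ 1 ∧ HolderWith C r g) ∧
      ∀ x : J, Tendsto W (𝓝[Icc A B \ {(x : ℝ)}] x) (𝓝 (g x)) := by
  have hne : ∀ x ∈ Icc A B, (𝓝[Icc A B \ {x}] x).NeBot := fun x hx =>
    neBot_nhdsWithin_Icc_diff hAB hx
  have hloc : ∀ x ∈ J, ∃ k, HolderAt (Icc A B) k x ∧ ∃ δ > 0, ∀ y ∈ Icc A B, |y - x| < δ →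
      Tendsto W (𝓝[Icc A B \ {y}] y) (𝓝 (k y)) := by
    intro x hx
    obtain ⟨k, hk, h⟩ := hW x hx
    obtain ⟨δ, hδ, hc⟩ := hk.continuousWithinAt
    obtain ⟨ε, hε, h1⟩ := Metric.mem_nhdsWithin_iff.1 h
    refine ⟨k, hk, min δ ε, lt_min hδ hε, fun y hy hyx => ?_⟩
    rw [lt_min_iff] at hyx
    refine Tendsto.congr' ?_ ((hc y hy hyx.1).tendsto.mono_left (nhdsWithin_mono _ sdiff_subset))
    have h2 : ∀ᶠ z in 𝓝[Icc A B \ {y}] y, |z - x| < ε :=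
      nhdsWithin_le_nhds ((isOpen_lt (by fun_prop) continuous_const).mem_nhds hyx.2)
    have h3 : ∀ᶠ z in 𝓝[Icc A B \ {y}] y, z ≠ x := by
      by_cases hyx' : y = x
      · filter_upwards [self_mem_nhdsWithin] with z hz
        rw [← hyx']
        exact hz.2
      · exact nhdsWithin_le_nhds (isOpen_ne.mem_nhds hyx')
    filter_upwards [h2, h3, self_mem_nhdsWithin] with z hz hz' hz''
    have h4 : W z = 0 * Real.log (z - x) + k z := h1 ⟨hz, hz''.1, hz'⟩
    rw [h4]
    ring
  have hg : ∀ x : J, ∃ l, Tendsto W (𝓝[Icc A B \ {(x : ℝ)}] x) (𝓝 l) := by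
    intro x
    obtain ⟨k, -, δ, hδ, h⟩ := hloc x x.2
    exact ⟨k x, h x (hJI x.2) (by simpa using hδ)⟩
  choose g hg using hg
  refine ⟨g, ?_, hg⟩
  -- Only `x` is confined to a patch, while `y` is any point of `J` close to it; this makes the
  -- property stable under finite unions, as compactness requires. Distances at least `δ` are
  -- handled later by the bound on `g`.
  have hpat : ∃ C r δ : ℝ, 0 ≤ C ∧ 0 < r ∧ r ≤ 1 ∧ 0 < δ ∧ δ ≤ 1 ∧ ∀ x : J, (x : ℝ) ∈ J →
      ∀ y : J, dist x y < δ → |g x - g y| ≤ C * dist x y ^ r := by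
    refine hJ.induction_on (p := fun s => ∃ C r δ : ℝ, 0 ≤ C ∧ 0 < r ∧ r ≤ 1 ∧ 0 < δ ∧ δ ≤ 1 ∧
      ∀ x : J, (x : ℝ) ∈ s → ∀ y : J, dist x y < δ → |g x - g y| ≤ C * dist x y ^ r)
      ⟨0, 1, 1, by simp⟩ ?_ ?_ ?_
    · rintro s t hst ⟨C, r, δ, hC, hr, hr1, hδ, hδ1, h⟩
      exact ⟨C, r, δ, hC, hr, hr1, hδ, hδ1, fun x hx => h x (hst hx)⟩
    · rintro s t ⟨C, r, δ, hC, hr, hr1, hδ, hδ1, h⟩ ⟨C', r', δ', hC', hr', hr1', hδ', hδ1', h'⟩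
      refine ⟨max C C', min r r', min δ δ', le_max_of_le_left hC, lt_min hr hr',
        (min_le_left _ _).trans hr1, lt_min hδ hδ', (min_le_left _ _).trans hδ1,
        fun x hx y hxy => ?_⟩
      rw [lt_min_iff] at hxy
      have h0 : 0 ≤ dist x y := dist_nonneg
      have h1 : dist x y ≤ 1 := hxy.1.le.trans hδ1
      rcases hx with hx | hx
      · refine (h x hx y hxy.1).trans ?_
        gcongr ?_ * ?_
        · exact le_max_left _ _
        · exact Real.rpow_le_rpow_of_exponent_ge' h0 h1 (lt_min hr hr').le (min_le_left _ _)
      · refine (h' x hx y hxy.2).trans ?_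
        gcongr ?_ * ?_
        · exact le_max_right _ _
        · exact Real.rpow_le_rpow_of_exponent_ge' h0 h1 (lt_min hr hr').le (min_le_right _ _)
    · intro x₀ hx₀
      obtain ⟨k, ⟨C, r, δ, hC, hr, hr1, hδ, hδ1, h⟩, ε, hε, h'⟩ := hloc x₀ hx₀
      refine ⟨Metric.ball x₀ (min δ ε / 2),
        nhdsWithin_le_nhds (Metric.ball_mem_nhds _ (by positivity)), C, r, min (min δ ε / 2) 1, hC,
        hr, hr1, by positivity, min_le_right _ _, fun x hx y hxy => ?_⟩
      rw [Metric.mem_ball, Real.dist_eq] at hx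
      rw [Subtype.dist_eq, Real.dist_eq] at hxy ⊢
      have hxy := hxy.trans_le (min_le_left _ _)
      have hmin : 0 < min δ ε := lt_min hδ hε
      have hx2 : |(x : ℝ) - x₀| < min δ ε := by linarith
      have hy2 : |(y : ℝ) - x₀| < min δ ε := by
        rw [abs_lt] at hx hxy ⊢
        constructor <;> linarith
      rw [lt_min_iff] at hx2 hy2
      have := hne x (hJI x.2)
      have := hne y (hJI y.2)
      rw [tendsto_nhds_unique (hg x) (h' x (hJI x.2) hx2.2),
        tendsto_nhds_unique (hg y) (h' y (hJI y.2) hy2.2)]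
      exact h x (hJI x.2) y (hJI y.2) hx2.1 hy2.1
  obtain ⟨C, r, δ, hC, hr, hr1, hδ, hδ1, h⟩ := hpat
  have hgc : Continuous g := by
    rw [continuous_iff_continuousAt]
    intro x
    rw [ContinuousAt, tendsto_iff_dist_tendsto_zero]
    have h0 : Tendsto (fun y : J => C * dist x y ^ r) (𝓝 x) (𝓝 0) := by
      have : ContinuousAt (fun y : J => C * dist x y ^ r) x :=
        continuousAt_const.mul (ContinuousAt.rpow_const (by fun_prop) (Or.inr hr.le))
      have h2 := this.tendsto
      simpa only [dist_self, Real.zero_rpow hr.ne', mul_zero] using h2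
    refine squeeze_zero' (Eventually.of_forall fun _ => dist_nonneg) ?_ h0
    filter_upwards [Metric.ball_mem_nhds x hδ] with y hy
    rw [dist_comm, Real.dist_eq]
    exact h x x.2 y (by rwa [Metric.mem_ball, dist_comm] at hy)
  have : CompactSpace J := isCompact_iff_compactSpace.1 hJ
  obtain ⟨M, hM⟩ := (isCompact_univ (X := J)).exists_bound_of_continuousOn hgc.continuousOn
  have hδr : 0 < δ ^ r := Real.rpow_pos_of_pos hδ r
  have hD : 0 ≤ max C (2 * M / δ ^ r) := le_max_of_le_left hC
  refine ⟨(max C (2 * M / δ ^ r)).toNNReal, r.toNNReal, by simpa using hr, by simpa using hr1,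
    holderWith_of_le hD hr.le fun x y => ?_⟩
  rcases lt_or_ge (dist x y) δ with hxy | hxy
  · refine (h x x.2 y hxy).trans ?_
    gcongr
    exact le_max_left _ _
  · have hMx := hM x trivial
    have hMy := hM y trivial
    rw [Real.norm_eq_abs] at hMx hMy
    have hM0 : 0 ≤ M := (abs_nonneg _).trans hMx
    calc |g x - g y| ≤ |g x| + |g y| := abs_sub _ _
      _ ≤ 2 * M := by linarith
      _ = 2 * M / δ ^ r * δ ^ r := by field_simp
      _ ≤ max C (2 * M / δ ^ r) * dist x y ^ r := by
          gcongr
          exact le_max_right _ _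

/-! ### Basic properties of the class of interval maps -/

theorem IsHolderOn.mono {g : ℝ → ℝ} {s t : Set ℝ} (h : IsHolderOn g t) (hst : s ⊆ t) :
    IsHolderOn g s := by
  obtain ⟨C, r, h0, h1, h⟩ := h
  exact ⟨C, r, h0, h1, h.mono hst⟩

theorem IsHolderOn.continuousOn {g : ℝ → ℝ} {s : Set ℝ} (h : IsHolderOn g s) :
    ContinuousOn g s := by
  obtain ⟨C, r, h0, -, h⟩ := h
  exact h.continuousOn h0

theorem isCompact_julia (a b : ℝ) (f : ℝ → ℝ) : IsCompact (julia a b f) := by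
  refine isCompact_Icc.of_isClosed_subset (s := Icc a b) ?_ fun x hx => hx.1
  rw [← isOpen_compl_iff, isOpen_iff_mem_nhds]
  intro x hx
  by_cases hxI : x ∈ Icc a b
  · have : ∃ V ∈ 𝓝[Icc a b] x, EquicontinuousOn (fun n : ℕ => f^[n]) (V ∩ Icc a b) := by
      by_contra! h
      exact hx ⟨hxI, h⟩
    obtain ⟨V, hV, hE⟩ := this
    obtain ⟨U, hU, hxU, hUV⟩ := mem_nhdsWithin.1 hV
    filter_upwards [hU.mem_nhds hxU] with y hy hyJ
    exact hyJ.2 V (mem_nhdsWithin.2 ⟨U, hU, hy, hUV⟩) hE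
  · filter_upwards [isClosed_Icc.isOpen_compl.mem_nhds hxI] with y hy hyJ
    exact hy hyJ.1

theorem LogSing.tendsto_of_zero {s : Set ℝ} {u : ℝ → ℝ} {x₀ : ℝ} (h : LogSing s u x₀ 0)
    (hx₀ : x₀ ∈ s) : ∃ l, Tendsto u (𝓝[s \ {x₀}] x₀) (𝓝 l) := by
  obtain ⟨k, hk, h⟩ := h
  obtain ⟨δ, hδ, hc⟩ := hk.continuousWithinAt
  refine ⟨k x₀, Tendsto.congr' ?_ ((hc x₀ hx₀ (by simpa using hδ)).tendsto.mono_left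
    (nhdsWithin_mono _ sdiff_subset))⟩
  filter_upwards [h] with x hx
  rw [hx]
  ring

namespace ClassA

variable {a b : ℝ} {f : ℝ → ℝ}

theorem lt (hf : ClassA a b f) : a < b := by
  obtain ⟨x, hx, y, hy, hxy⟩ := hf.nontrivial_julia
  rcases lt_or_gt_of_ne hxy with h | h
  · exact hx.1.1.trans_lt (h.trans_le hy.1.2)
  · exact hy.1.1.trans_lt (h.trans_le hx.1.2)

theorem hasDerivWithinAt (hf : ClassA a b f) {x : ℝ} (hx : x ∈ Icc a b) :
    HasDerivWithinAt f (intervalDeriv a b f x) (Icc a b) x :=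
  (hf.differentiableOn x hx).hasDerivWithinAt

theorem mapsTo_julia (hf : ClassA a b f) : MapsTo f (julia a b f) (julia a b f) :=
  mapsTo_iff_image_subset.2 hf.image_julia.subset

theorem finite_critJulia (hf : ClassA a b f) : (critJulia a b f).Finite :=
  hf.finite_critSet.subset inter_subset_left

theorem exists_lipschitz (hf : ClassA a b f) :
    ∃ K, ∀ x ∈ Icc a b, ∀ y ∈ Icc a b, |f x - f y| ≤ K * |x - y| := by
  obtain ⟨K, hK⟩ := isCompact_Icc.exists_bound_of_continuousOn hf.holder_deriv.continuousOn
  exact ⟨K, fun x hx y hy => (convex_Icc a b).norm_image_sub_le_of_norm_hasDerivWithin_le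
    (fun z hz => hf.hasDerivWithinAt hz) hK hy hx⟩

/-- By Rolle, two points of a fibre are separated by a critical point. Hence `x ↦ Crit ∩ (-∞, x)` is
injective on the fibre, with values among the subsets of a finite set. -/
theorem finite_preimage_singleton (hf : ClassA a b f) (z : ℝ) :
    (Icc a b ∩ f ⁻¹' {z}).Finite := by
  have key : ∀ x ∈ Icc a b ∩ f ⁻¹' {z}, ∀ y ∈ Icc a b ∩ f ⁻¹' {z}, x < y →
      ∃ c ∈ critSet a b f, x < c ∧ c < y := by
    intro x hx y hy hxy
    obtain ⟨c, hc, hc'⟩ := exists_deriv_eq_zero hxy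
      (hf.differentiableOn.continuousOn.mono (Icc_subset_Icc hx.1.1 hy.1.2))
      (hx.2.trans hy.2.symm)
    have h1 : a < c := hx.1.1.trans_lt hc.1
    have h2 : c < b := hc.2.trans_le hy.1.2
    refine ⟨c, ⟨⟨h1.le, h2.le⟩, ?_⟩, hc.1, hc.2⟩
    rw [intervalDeriv, derivWithin_of_mem_nhds (Icc_mem_nhds h1 h2), hc']
  refine Set.Finite.of_finite_image (f := fun x => critSet a b f ∩ Iio x)
    (hf.finite_critSet.finite_subsets.subset ?_) ?_
  · rintro _ ⟨x, -, rfl⟩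
    exact inter_subset_left
  · have aux : ∀ x ∈ Icc a b ∩ f ⁻¹' {z}, ∀ y ∈ Icc a b ∩ f ⁻¹' {z},
        critSet a b f ∩ Iio x = critSet a b f ∩ Iio y → ¬ x < y := by
      intro x hx y hy hxy hlt
      obtain ⟨c, hc, h1, h2⟩ := key x hx y hy hlt
      have : c ∈ critSet a b f ∩ Iio x := by rw [hxy]; exact ⟨hc, h2⟩
      exact absurd this.2 (not_lt.2 h1.le)
    intro x hx y hy hxy
    exact le_antisymm (not_lt.1 (aux y hy x hx hxy.symm)) (not_lt.1 (aux x hx y hy hxy))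

theorem finite_preimage (hf : ClassA a b f) {S : Set ℝ} (hS : S.Finite) :
    (Icc a b ∩ f ⁻¹' S).Finite := by
  have : Icc a b ∩ f ⁻¹' S = ⋃ z ∈ S, Icc a b ∩ f ⁻¹' {z} := by
    ext x
    simp
  rw [this]
  exact hS.biUnion fun z _ => hf.finite_preimage_singleton z

theorem finite_iterate_preimage (hf : ClassA a b f) {S : Set ℝ} (hS : S.Finite) (n : ℕ) :
    (Icc a b ∩ f^[n] ⁻¹' S).Finite := by
  induction n with
  | zero => exact hS.subset inter_subset_right
  | succ n ih =>
    refine (hf.finite_preimage ih).subset fun x hx => ⟨hx.1, hf.mapsTo hx.1, ?_⟩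
    simpa [Function.iterate_succ] using hx.2

/-- A critical point in the Julia set is not periodic. -/
theorem iterate_ne_of_mem_critJulia (hf : ClassA a b f) {c : ℝ} (hc : c ∈ critJulia a b f)
    (n : ℕ) : f^[n] (f c) ≠ c := by
  intro h
  have hd : DifferentiableOn ℝ f^[n] (Icc a b) := by
    clear h
    induction n with
    | zero => exact differentiableOn_id
    | succ n ih => exact ih.comp hf.differentiableOn hf.mapsTo
  have h1 := hf.repelling c hc.2 (n + 1) n.succ_pos h
  have h2 := (hd (f c) (hf.mapsTo hc.1.1)).hasDerivWithinAt.comp c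
    (hf.hasDerivWithinAt hc.1.1) hf.mapsTo
  rw [hc.1.2, mul_zero] at h2
  have h3 : intervalDeriv a b f^[n + 1] c = 0 :=
    h2.derivWithin (uniqueDiffOn_Icc hf.lt c hc.1.1)
  rw [h3, abs_zero] at h1
  linarith

/-- The logarithm of `|ψ ∘ f| = |φ| ^ ℓ` gives the order of `f - f c`; differentiating that
logarithmic identity expresses `Df` through `φ`, `ψ` and their derivatives and gives the order `ℓ -
1`. If `ℓ = 1`, then `log |Df|` would have a finite limit at `c`, although `Df` tends to `0` there.
-/
theorem exists_order_of_mem_critJulia (hf : ClassA a b f) {c : ℝ} (hc : c ∈ critJulia a b f) :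
    ∃ ℓ : ℝ, 1 < ℓ ∧ LogSing (Icc a b) (fun x => Real.log (f x - f c)) c ℓ ∧
      LogSing (Icc a b) (fun x => Real.log (intervalDeriv a b f x)) c (ℓ - 1) := by
  have hcI : c ∈ Icc a b := hc.1.1
  have hfcI : f c ∈ Icc a b := hf.mapsTo hcI
  obtain ⟨K, hK⟩ := hf.exists_lipschitz
  have hfc : ContinuousWithinAt f (Icc a b) c := (hf.hasDerivWithinAt hcI).continuousWithinAt
  obtain ⟨ℓ, φ, ψ, hℓ, hφ, hψ, hφc, hψc, hev⟩ := hf.nonflat c hc.1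
  have hφd : ∀ x ∈ Icc a b, HasDerivWithinAt φ (deriv φ x) (Icc a b) x := fun x _ =>
    (hφ.differentiable x).hasDerivAt.hasDerivWithinAt
  have hψd : ∀ x ∈ Icc a b, HasDerivWithinAt ψ (deriv ψ x) (Icc a b) x := fun x _ =>
    (hψ.differentiable x).hasDerivAt.hasDerivWithinAt
  have hφs : LogSing (Icc a b) (fun x => Real.log (φ x)) c 1 := by
    simpa [hφc] using logSing_log_sub_of_deriv_ne_zero hφd (hφ.holder_deriv.mono (subset_univ _))
      hcI (hφ.deriv_ne_zero c)
  have hψs : LogSing (Icc a b) (fun x => Real.log (ψ x)) (f c) 1 := by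
    simpa [hψc] using logSing_log_sub_of_deriv_ne_zero hψd (hψ.holder_deriv.mono (subset_univ _))
      hfcI (hψ.deriv_ne_zero (f c))
  obtain ⟨U, hUo, hcU, hU⟩ := mem_nhdsWithin.1 hev
  have hU' : ∀ x ∈ Icc a b, x ∈ U → |ψ (f x)| = |φ x| ^ ℓ := fun x hx hxU => hU ⟨hxU, hx⟩
  have hφ0 : ∀ x, x ≠ c → φ x ≠ 0 := fun x hx h0 =>
    hx (hφ.bijective.1 (h0.trans hφc.symm))
  have hlog : ∀ x ∈ Icc a b, x ∈ U → x ≠ c →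
      ψ (f x) ≠ 0 ∧ Real.log (ψ (f x)) = ℓ * Real.log (φ x) := by
    intro x hx hxU hxc
    have h1 : 0 < |φ x| := abs_pos.2 (hφ0 x hxc)
    constructor
    · rw [← abs_pos, hU' x hx hxU]
      exact Real.rpow_pos_of_pos h1 _
    · rw [← Real.log_abs, hU' x hx hxU, Real.log_rpow h1, Real.log_abs]
  have hUev : ∀ᶠ x in 𝓝[Icc a b \ {c}] c, x ∈ U :=
    nhdsWithin_le_nhds (hUo.mem_nhds hcU)
  have hval : LogSing (Icc a b) (fun x => Real.log (f x - f c)) c ℓ := by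
    obtain ⟨k, hk, hψk⟩ := hψs
    have hsum : LogSing (Icc a b) (fun x => ℓ * Real.log (φ x) + (-1) * k (f x)) c ℓ := by
      simpa using (hφs.const_mul ℓ).add
        ((hk.comp_lipschitz hf.mapsTo hcI hK).logSing.const_mul (-1))
    refine hsum.congr ?_
    have hψk' : ∀ᶠ y in 𝓝[Icc a b] (f c), y ≠ f c →
        Real.log (ψ y) = 1 * Real.log (y - f c) + k y := by
      rw [eventually_nhdsWithin_iff] at hψk ⊢
      filter_upwards [hψk] with y hy hyI hne
      exact hy ⟨hyI, hne⟩
    have hpull := (hfc.tendsto_nhdsWithin hf.mapsTo).eventually hψk'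
    filter_upwards [nhdsWithin_mono _ sdiff_subset hpull, hUev, self_mem_nhdsWithin] with
      x hx hxU hxI
    obtain ⟨h1, h2⟩ := hlog x hxI.1 hxU hxI.2
    have h3 := hx fun h => h1 (by rw [h, hψc])
    rw [← h2, h3]
    ring
  have hder : LogSing (Icc a b) (fun x => Real.log (intervalDeriv a b f x)) c (ℓ - 1) := by
    have hφ' : LogSing (Icc a b) (fun x => Real.log (deriv φ x)) c 0 :=
      (((hφ.holder_deriv.mono (subset_univ _)).holderAt c).log hcI (hφ.deriv_ne_zero c)).logSing
    have hψ' : LogSing (Icc a b) (fun x => Real.log (deriv ψ (f x))) c 0 :=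
      ((((hψ.holder_deriv.mono (subset_univ _)).holderAt (f c)).log hfcI
        (hψ.deriv_ne_zero (f c))).comp_lipschitz hf.mapsTo hcI hK).logSing
    have hsum : LogSing (Icc a b) (fun x => Real.log ℓ + (Real.log (deriv φ x) +
        ((ℓ - 1) * Real.log (φ x) + (-1) * Real.log (deriv ψ (f x))))) c (ℓ - 1) := by
      simpa using (holderAt_const (Icc a b) (Real.log ℓ) c).logSing.add
        (hφ'.add ((hφs.const_mul (ℓ - 1)).add (hψ'.const_mul (-1))))
    refine hsum.congr ?_
    filter_upwards [hUev, self_mem_nhdsWithin] with x hxU hxI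
    obtain ⟨h1, h2⟩ := hlog x hxI.1 hxU hxI.2
    have h3 := hφ0 x hxI.2
    have hd1 : HasDerivWithinAt (fun y => Real.log (ψ (f y)))
        (deriv ψ (f x) * intervalDeriv a b f x / ψ (f x)) (Icc a b) x :=
      (((hψ.differentiable (f x)).hasDerivAt.comp_hasDerivWithinAt x
        (hf.hasDerivWithinAt hxI.1))).log h1
    have hd2 : HasDerivWithinAt (fun y => ℓ * Real.log (φ y)) (ℓ * (deriv φ x / φ x))
        (Icc a b) x := ((hφd x hxI.1).log h3).const_mul ℓ
    have hd3 : HasDerivWithinAt (fun y => Real.log (ψ (f y))) (ℓ * (deriv φ x / φ x))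
        (Icc a b) x := by
      refine hd2.congr_of_eventuallyEq ?_ h2
      have hne : ∀ᶠ y in 𝓝[Icc a b] x, y ≠ c :=
        nhdsWithin_le_nhds (isOpen_ne.mem_nhds hxI.2)
      filter_upwards [hne, nhdsWithin_le_nhds (hUo.mem_nhds hxU), self_mem_nhdsWithin] with
        y hy hyU hyI
      exact (hlog y hyI hyU hy).2
    have heq := (uniqueDiffOn_Icc hf.lt x hxI.1).eq_deriv _ hd1 hd3
    have h4 := hψ.deriv_ne_zero (f x)
    have h5 := hφ.deriv_ne_zero x
    have h6 : intervalDeriv a b f x = ℓ * deriv φ x * ψ (f x) / (φ x * deriv ψ (f x)) := by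
      field_simp at heq ⊢
      linarith
    have hℓ0 : ℓ ≠ 0 := by linarith
    rw [h6, Real.log_div (by positivity) (by positivity), Real.log_mul (by positivity) h1,
      Real.log_mul hℓ0 h5, Real.log_mul h3 h4, h2]
    ring
  refine ⟨ℓ, lt_of_le_of_ne hℓ ?_, hval, hder⟩
  rintro rfl
  rw [sub_self] at hder
  obtain ⟨l, hl⟩ := hder.tendsto_of_zero hcI
  have := neBot_nhdsWithin_Icc_diff hf.lt hcI
  have h0 : Tendsto (intervalDeriv a b f) (𝓝[Icc a b \ {c}] c) (𝓝[≠] 0) := by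
    refine tendsto_nhdsWithin_iff.2 ⟨?_, ?_⟩
    · have h1 := (hf.holder_deriv.continuousOn c hcI).tendsto
      rw [hc.1.2] at h1
      exact h1.mono_left (nhdsWithin_mono _ sdiff_subset)
    · have h1 : ∀ᶠ x in 𝓝[Icc a b \ {c}] c, x ∉ critSet a b f \ {c} :=
        nhdsWithin_le_nhds ((hf.finite_critSet.sdiff).isClosed.isOpen_compl.mem_nhds (by simp))
      filter_upwards [h1, self_mem_nhdsWithin] with x hx hxI h
      exact hx ⟨⟨hxI.1, h⟩, hxI.2⟩
  exact not_tendsto_nhds_of_tendsto_atBot (Real.tendsto_log_nhdsNE_zero.comp h0) l hl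

/-- The local order of `f` at the points of the Julia set. -/
theorem exists_order (hf : ClassA a b f) :
    ∃ ℓ : ℝ → ℝ, (∀ x, 1 ≤ ℓ x) ∧ (∀ x, x ∉ critJulia a b f → ℓ x = 1) ∧
      (∀ x ∈ critJulia a b f, 1 < ℓ x) ∧
      ∀ x ∈ julia a b f, LogSing (Icc a b) (fun y => Real.log (f y - f x)) x (ℓ x) ∧
        LogSing (Icc a b) (fun y => Real.log (intervalDeriv a b f y)) x (ℓ x - 1) := by
  classical
  choose! ℓ h1 h2 h3 using fun c hc => hf.exists_order_of_mem_critJulia (c := c) hc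
  refine ⟨fun x => if x ∈ critJulia a b f then ℓ x else 1, fun x => ?_, fun x hx => if_neg hx,
    fun x hx => by simpa only [if_pos hx] using h1 x hx, fun x hx => ?_⟩
  · dsimp only
    split_ifs with h
    · exact (h1 x h).le
    · exact le_rfl
  · by_cases h : x ∈ critJulia a b f
    · simpa only [if_pos h] using ⟨h2 x h, h3 x h⟩
    · have h0 : intervalDeriv a b f x ≠ 0 := fun h0 => h ⟨⟨hx.1, h0⟩, hx⟩
      simp only [if_neg h, sub_self]
      exact ⟨logSing_log_sub_of_deriv_ne_zero (fun y hy => hf.hasDerivWithinAt hy)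
        hf.holder_deriv hx.1 h0, ((hf.holder_deriv.holderAt x).log hx.1 h0).logSing⟩

end ClassA

/-! ### Exceptional sets -/

namespace ClassA

variable {a b : ℝ} {f : ℝ → ℝ}

theorem exists_subset_iterate_image (hf : ClassA a b f) {U : Set ℝ} (hU : IsOpen U)
    (hne : (U ∩ julia a b f).Nonempty) :
    ∃ n, ∀ m ≥ n, julia a b f ⊆ f^[m] '' (U ∩ julia a b f) := by
  obtain ⟨n, hn⟩ := hf.exact U hU hne
  refine ⟨n, fun m hm => ?_⟩
  induction m, hm using Nat.le_induction with
  | base => exact hn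
  | succ m _ ih =>
    intro x hx
    rw [← hf.image_julia] at hx
    obtain ⟨y, hy, rfl⟩ := hx
    obtain ⟨z, hz, rfl⟩ := ih hy
    exact ⟨z, hz, Function.iterate_succ_apply' f m z⟩

/-- If `J` were finite, one of its points would form a relatively open set, and exactness would make
`J` the image of that single point. -/
theorem infinite_julia (hf : ClassA a b f) : (julia a b f).Infinite := by
  intro hfin
  obtain ⟨x, hx, y, hy, hxy⟩ := hf.nontrivial_julia
  obtain ⟨n, hn⟩ := hf.exact (julia a b f \ {x})ᶜ hfin.sdiff.isClosed.isOpen_compl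
    ⟨x, by simp, hx⟩
  have h1 : ∀ z ∈ (julia a b f \ {x})ᶜ ∩ julia a b f, z = x := by
    rintro z ⟨hz, hz'⟩
    by_contra h
    exact hz ⟨hz', h⟩
  obtain ⟨z, hz, hzx⟩ := hn hx
  obtain ⟨w, hw, hwy⟩ := hn hy
  rw [h1 z hz] at hzx
  rw [h1 w hw] at hwy
  exact hxy (hzx.symm.trans hwy)

/-- If `f⁻¹(S) ⊆ S` in `J`, orbits starting in `J \ S` never reach `S`. But `J \ S` is relatively
open and, `J` being infinite, non-empty, so exactness is contradicted. -/
theorem nonempty_preimage_diff (hf : ClassA a b f) {S : Set ℝ} (hS : S.Nonempty)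
    (hfin : S.Finite) (hSJ : S ⊆ julia a b f) : ((julia a b f ∩ f ⁻¹' S) \ S).Nonempty := by
  by_contra hempty
  rw [Set.not_nonempty_iff_eq_empty, sdiff_eq_empty] at hempty
  obtain ⟨x, hx, hxS⟩ := (hf.infinite_julia.sdiff hfin).nonempty
  obtain ⟨n, hn⟩ := hf.exact Sᶜ hfin.isClosed.isOpen_compl ⟨x, hxS, hx⟩
  have key : ∀ n : ℕ, ∀ y ∈ julia a b f, y ∉ S → f^[n] y ∉ S := by
    intro n
    induction n with
    | zero => exact fun y _ h => h
    | succ n ih =>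
      intro y hy hyS
      exact ih (f y) (hf.mapsTo_julia hy) fun h => hyS (hempty ⟨hy, h⟩)
  obtain ⟨s, hs⟩ := hS
  obtain ⟨y, hy, rfl⟩ := hn (hSJ hs)
  exact key n y hy.2 hy.1 hs

theorem isExceptionalSet_of_diff_subset (hf : ClassA a b f) {S Λ : Set ℝ} (hS : S.Nonempty)
    (hfin : S.Finite) (hSJ : S ⊆ julia a b f) (hfS : MapsTo f S S)
    (hΛ : (julia a b f ∩ f ⁻¹' S) \ S ⊆ Λ) : IsExceptionalSet a b f Λ S :=
  ⟨hS, hfin, hSJ, hfS, hf.nonempty_preimage_diff hS hfin hSJ, hΛ⟩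

theorem isExceptionalSet_union (hf : ClassA a b f) {Λ S S' : Set ℝ}
    (hS : IsExceptionalSet a b f Λ S) (hS' : IsExceptionalSet a b f Λ S') :
    IsExceptionalSet a b f Λ (S ∪ S') := by
  refine hf.isExceptionalSet_of_diff_subset (hS.nonempty.mono subset_union_left)
    (hS.finite.union hS'.finite) (union_subset hS.subset_julia hS'.subset_julia)
    (hS.forward.union_union hS'.forward) ?_
  rintro x ⟨⟨hx, hx1 | hx1⟩, hx2⟩
  · exact hS.diff_subset ⟨⟨hx, hx1⟩, fun h => hx2 (Or.inl h)⟩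
  · exact hS'.diff_subset ⟨⟨hx, hx1⟩, fun h => hx2 (Or.inr h)⟩

/-- For two disjoint open sets meeting `J`, some `f^n` maps the trace of each onto `J`, so every
point of `S` has two distinct preimages under `f^n`. Backward orbits leave `S` only through `Crit'`,
so these `2 * S.ncard` points lie in `S ∪ E` with `E` finite and independent of `S`. -/
theorem exists_ncard_exceptional_le (hf : ClassA a b f) :
    ∃ N, ∀ S, IsExceptionalSet a b f (critJulia a b f) S → S.ncard ≤ N := by
  obtain ⟨p, hp, q, hq, hpq⟩ := hf.nontrivial_julia
  obtain ⟨U, V, hU, hV, hpU, hqV, hUV⟩ := t2_separation hpq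
  obtain ⟨n₁, h₁⟩ := hf.exists_subset_iterate_image hU ⟨p, hpU, hp⟩
  obtain ⟨n₂, h₂⟩ := hf.exists_subset_iterate_image hV ⟨q, hqV, hq⟩
  set n := max n₁ n₂
  choose! σ hσ hσ' using h₁ n (le_max_left _ _)
  choose! τ hτ hτ' using h₂ n (le_max_right _ _)
  let E : Set ℝ := ⋃ k ∈ Finset.range n, Icc a b ∩ f^[k] ⁻¹' critJulia a b f
  have hE : E.Finite := Set.Finite.biUnion (Finset.finite_toSet _) fun k _ =>
    hf.finite_iterate_preimage hf.finite_critJulia k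
  refine ⟨E.ncard, fun S hS => ?_⟩
  have key : ∀ n : ℕ, ∀ x ∈ julia a b f, f^[n] x ∈ S →
      x ∈ S ∨ ∃ k < n, f^[k] x ∈ critJulia a b f := by
    intro n
    induction n with
    | zero => exact fun x _ h => Or.inl h
    | succ n ih =>
      intro x hx h
      rcases ih (f x) (hf.mapsTo_julia hx) h with h | ⟨k, hk, h⟩
      · by_cases hxS : x ∈ S
        · exact Or.inl hxS
        · exact Or.inr ⟨0, n.succ_pos, hS.diff_subset ⟨⟨hx, h⟩, hxS⟩⟩
      · exact Or.inr ⟨k + 1, Nat.succ_lt_succ hk, h⟩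
  have key' : ∀ x ∈ julia a b f, f^[n] x ∈ S → x ∈ S ∪ E := by
    intro x hx h
    rcases key n x hx h with h | ⟨k, hk, h⟩
    · exact Or.inl h
    · refine Or.inr (mem_biUnion (Finset.mem_coe.2 (Finset.mem_range.2 hk)) ⟨hx.1, h⟩)
  have hsub : σ '' S ∪ τ '' S ⊆ S ∪ E := by
    rintro _ (⟨x, hx, rfl⟩ | ⟨x, hx, rfl⟩)
    · exact key' _ (hσ (hS.subset_julia hx)).2 (by rwa [hσ' (hS.subset_julia hx)])
    · exact key' _ (hτ (hS.subset_julia hx)).2 (by rwa [hτ' (hS.subset_julia hx)])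
  have hσi : InjOn σ S := fun x hx y hy h => by
    rw [← hσ' (hS.subset_julia hx), h, hσ' (hS.subset_julia hy)]
  have hτi : InjOn τ S := fun x hx y hy h => by
    rw [← hτ' (hS.subset_julia hx), h, hτ' (hS.subset_julia hy)]
  have hdisj : Disjoint (σ '' S) (τ '' S) := by
    refine hUV.mono ?_ ?_
    · rintro _ ⟨x, hx, rfl⟩
      exact (hσ (hS.subset_julia hx)).1
    · rintro _ ⟨x, hx, rfl⟩
      exact (hτ (hS.subset_julia hx)).1
  have h1 := ncard_le_ncard hsub (hS.finite.union hE)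
  rw [ncard_union_eq hdisj (hS.finite.image _) (hS.finite.image _), hσi.ncard_image,
    hτi.ncard_image] at h1
  have h2 := ncard_union_le S E
  omega

/-- The maximal exceptional set is empty or exceptional. -/
theorem sigmaMax_eq_empty_or (hf : ClassA a b f) :
    sigmaMax a b f = ∅ ∨ IsExceptionalSet a b f (critJulia a b f) (sigmaMax a b f) := by
  rcases Set.eq_empty_or_nonempty {S | IsExceptionalSet a b f (critJulia a b f) S} with h | h
  · left
    rw [sigmaMax, h, sUnion_empty]
  · right
    obtain ⟨N, hN⟩ := hf.exists_ncard_exceptional_le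
    have hbdd : BddAbove (ncard '' {S | IsExceptionalSet a b f (critJulia a b f) S}) := by
      refine ⟨N, ?_⟩
      rintro _ ⟨S, hS, rfl⟩
      exact hN S hS
    -- An exceptional set of maximal cardinality contains every other one, because unions of two are
    -- again exceptional.
    obtain ⟨S, hS, hSmax⟩ := Nat.sSup_mem (h.image ncard) hbdd
    have : sigmaMax a b f = S := by
      refine Subset.antisymm (sUnion_subset fun S' hS' => ?_) (subset_sUnion_of_mem hS)
      have hu := hf.isExceptionalSet_union hS hS'
      have h1 : (S ∪ S').ncard ≤ S.ncard := by
        rw [hSmax]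
        exact le_csSup hbdd ⟨_, hu, rfl⟩
      rw [Set.eq_of_subset_of_ncard_le subset_union_left h1 hu.finite]
      exact subset_union_right
    rwa [this]

theorem finite_sigmaMax (hf : ClassA a b f) : (sigmaMax a b f).Finite := by
  rcases hf.sigmaMax_eq_empty_or with h | h
  · rw [h]
    exact finite_empty
  · exact h.finite

theorem sigmaMax_subset_julia (a b : ℝ) (f : ℝ → ℝ) : sigmaMax a b f ⊆ julia a b f :=
  sUnion_subset fun _ hS => hS.subset_julia

theorem mapsTo_sigmaMax (a b : ℝ) (f : ℝ → ℝ) : MapsTo f (sigmaMax a b f) (sigmaMax a b f) := by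
  rintro x ⟨S, hS, hx⟩
  exact ⟨S, hS, hS.forward hx⟩

theorem mem_critJulia_of_map_mem_sigmaMax {x : ℝ} (hx : x ∈ julia a b f)
    (hfx : f x ∈ sigmaMax a b f) (hxS : x ∉ sigmaMax a b f) : x ∈ critJulia a b f := by
  obtain ⟨S, hS, hfx⟩ := hfx
  exact hS.diff_subset ⟨⟨hx, hfx⟩, fun h => hxS ⟨S, hS, h⟩⟩

/-! ### Orders along orbits and the weights on the maximal exceptional set. -/

open Classical in
/-- The product of the local orders over the critical points in the forward orbit of `x`. -/
noncomputable def totalOrder (hf : ClassA a b f) (ℓ : ℝ → ℝ) (x : ℝ) : ℝ :=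
  ∏ c ∈ hf.finite_critJulia.toFinset with ∃ n, f^[n] x = c, ℓ c

/-- A critical `x ∈ J` does not recur in the orbit of `f x`, so passing from `f x` to `x` adds the
factor `ℓ x` exactly once; a point outside `Crit'` contributes the factor `1`. -/
theorem totalOrder_eq (hf : ClassA a b f) {ℓ : ℝ → ℝ} (hℓ : ∀ x ∉ critJulia a b f, ℓ x = 1)
    (x : ℝ) : hf.totalOrder ℓ x = ℓ x * hf.totalOrder ℓ (f x) := by
  classical
  have key : ∀ c, (∃ n, f^[n] x = c) ↔ x = c ∨ ∃ n, f^[n] (f x) = c := by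
    intro c
    constructor
    · rintro ⟨n | n, hn⟩
      · exact Or.inl hn
      · exact Or.inr ⟨n, hn⟩
    · rintro (h | ⟨n, hn⟩)
      · exact ⟨0, h⟩
      · exact ⟨n + 1, hn⟩
  by_cases hx : x ∈ critJulia a b f
  · have hnot : x ∉ {c ∈ hf.finite_critJulia.toFinset | ∃ n, f^[n] (f x) = c} := by
      simp only [Finset.mem_filter, not_and, not_exists]
      exact fun _ n => hf.iterate_ne_of_mem_critJulia hx n
    rw [totalOrder, totalOrder, ← Finset.prod_insert hnot]
    refine Finset.prod_congr ?_ fun _ _ => rfl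
    ext c
    simp only [Finset.mem_filter, Finset.mem_insert, key, Finite.mem_toFinset]
    constructor
    · rintro ⟨h, rfl | h'⟩
      · exact Or.inl rfl
      · exact Or.inr ⟨h, h'⟩
    · rintro (rfl | ⟨h, h'⟩)
      · exact ⟨hx, Or.inl rfl⟩
      · exact ⟨h, Or.inr h'⟩
  · rw [hℓ x hx, one_mul, totalOrder, totalOrder]
    refine Finset.prod_congr ?_ fun _ _ => rfl
    ext c
    simp only [Finset.mem_filter, key, Finite.mem_toFinset]
    refine and_congr_right fun h => or_iff_right ?_
    rintro rfl
    exact hx h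

theorem one_le_totalOrder (hf : ClassA a b f) {ℓ : ℝ → ℝ} (hℓ : ∀ x, 1 ≤ ℓ x) (x : ℝ) :
    1 ≤ hf.totalOrder ℓ x :=
  Finset.prod_induction _ (fun y => 1 ≤ y) (fun _ _ => one_le_mul_of_one_le_of_one_le) le_rfl
    fun c _ => hℓ c

/-- The weights `β = 1 + α` of the points of the maximal exceptional set. -/
theorem exists_weight (hf : ClassA a b f) {ℓ : ℝ → ℝ} (hℓ1 : ∀ x, 1 ≤ ℓ x)
    (hℓ : ∀ x ∉ critJulia a b f, ℓ x = 1) :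
    ∃ β : ℝ → ℝ, (∀ x, 0 < β x ∧ β x ≤ 1) ∧ (∀ x ∉ sigmaMax a b f, β x = 1) ∧
      (∀ x ∈ julia a b f, β x ≤ ℓ x * β (f x)) ∧
      (∀ x ∈ julia a b f, x ∉ critJulia a b f → β x = ℓ x * β (f x)) ∧
      ∀ S : Set ℝ, S.Nonempty → S.Finite → S ⊆ julia a b f → MapsTo f S S →
        ¬ (julia a b f ∩ f ⁻¹' S) \ S ⊆ {c ∈ critJulia a b f | β c < ℓ c * β (f c)} := by
  classical
  set Z := sigmaMax a b f with hZ
  set L := hf.totalOrder ℓ with hL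
  have hLeq : ∀ x, L x = ℓ x * L (f x) := hf.totalOrder_eq hℓ
  have hL1 : ∀ x, 1 ≤ L x := hf.one_le_totalOrder hℓ1
  have hLpos : ∀ x, 0 < L x := fun x => one_pos.trans_le (hL1 x)
  let Y : Set ℝ := (julia a b f ∩ f ⁻¹' Z) \ Z
  have hYfin : Y.Finite := (hf.finite_preimage hf.finite_sigmaMax).subset
    fun x hx => ⟨hx.1.1.1, hx.1.2⟩
  -- The orbits of `y` and `x` eventually meet. The condition is unchanged when `x` is replaced by
  -- `f x`, which makes `γ` below constant along orbits.
  let R : ℝ → ℝ → Prop := fun y x => ∃ m n, f^[m] y = f^[n] x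
  have hR : ∀ y x, R y x ↔ R y (f x) := by
    intro y x
    constructor
    · rintro ⟨m, n, h⟩
      refine ⟨m + 1, n, ?_⟩
      rw [Function.iterate_succ_apply', h, ← Function.iterate_succ_apply' f n x,
        Function.iterate_succ_apply]
    · rintro ⟨m, n, h⟩
      exact ⟨m, n + 1, h⟩
  let T : ℝ → Set ℝ := fun x => (fun y => (L y)⁻¹) '' {y ∈ Y | R y x}
  have hTfin : ∀ x, (T x).Finite := fun x => (hYfin.subset fun y hy => hy.1).image _
  -- On `Z` this is the least constant for the orbit class with `L y * γ ≥ 1` at all its entry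
  -- points `y ∈ Y`. Positivity and attainment of the supremum are needed only on `Z`.
  let γ : ℝ → ℝ := fun x => sSup (T x)
  have hγf : ∀ x, γ (f x) = γ x := by
    intro x
    have : {y ∈ Y | R y (f x)} = {y ∈ Y | R y x} := by
      ext y
      simp only [mem_ofPred_eq, hR y x]
    simp only [γ, T, this]
  have hγn : ∀ n x, γ (f^[n] x) = γ x := by
    intro n
    induction n with
    | zero => exact fun x => rfl
    | succ n ih => intro x; rw [Function.iterate_succ_apply, ih, hγf]
  have hZmap : ∀ {x}, x ∈ Z → f x ∈ Z := fun hx => mapsTo_sigmaMax a b f hx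
  -- The part of `Z` in the class of `x` has a preimage outside itself; this preimage is in the same
  -- class, hence outside `Z`.
  have hatt : ∀ x ∈ Z, ∃ y ∈ Y, R y x ∧ γ x = (L y)⁻¹ := by
    intro x hx
    have hne : (T x).Nonempty := by
      obtain ⟨y, ⟨hyJ, hyf⟩, hy⟩ := hf.nonempty_preimage_diff (S := {z ∈ Z | R z x})
        ⟨x, hx, 0, 0, rfl⟩ (hf.finite_sigmaMax.subset fun z hz => hz.1)
        (fun z hz => sigmaMax_subset_julia a b f hz.1)
      obtain ⟨hyf1, m, n, hyf2⟩ := hyf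
      have hyR : R y x := ⟨m + 1, n, hyf2⟩
      exact ⟨_, y, ⟨⟨⟨hyJ, hyf1⟩, fun h => hy ⟨h, hyR⟩⟩, hyR⟩, rfl⟩
    obtain ⟨y, hy, h⟩ := hne.csSup_mem (hTfin x)
    exact ⟨y, hy.1, hy.2, h.symm⟩
  have hγpos : ∀ x ∈ Z, 0 < γ x := by
    intro x hx
    obtain ⟨y, -, -, h⟩ := hatt x hx
    rw [h]
    exact inv_pos.2 (hLpos y)
  have hγle : ∀ y ∈ Y, 1 ≤ L y * γ y := by
    intro y hy
    have : (L y)⁻¹ ≤ γ y := le_csSup (hTfin y).bddAbove ⟨y, ⟨hy, 0, 0, rfl⟩, rfl⟩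
    calc 1 = L y * (L y)⁻¹ := (mul_inv_cancel₀ (hLpos y).ne').symm
      _ ≤ L y * γ y := by gcongr; exact (hLpos y).le
  -- `L * γ` alone would solve the equation `β x = ℓ x * β (f x)`; the cap at `1` ensures `α ≤ 0`.
  let β : ℝ → ℝ := fun x => if x ∈ Z then min 1 (L x * γ x) else 1
  have hβZ : ∀ x ∈ Z, β x = min 1 (L x * γ x) := fun x hx => if_pos hx
  have hβn : ∀ x ∉ Z, β x = 1 := fun x hx => if_neg hx
  have hβf : ∀ x, f x ∈ Z → ℓ x * β (f x) = min (ℓ x) (L x * γ x) := by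
    intro x hx
    rw [hβZ _ hx, hγf, mul_min_of_nonneg _ _ (zero_le_one.trans (hℓ1 x)), mul_one,
      ← mul_assoc, ← hLeq]
  refine ⟨β, fun x => ?_, hβn, fun x hx => ?_, fun x hx hxc => ?_, ?_⟩
  · by_cases hx : x ∈ Z
    · rw [hβZ x hx]
      exact ⟨lt_min one_pos (mul_pos (hLpos x) (hγpos x hx)), min_le_left _ _⟩
    · rw [hβn x hx]
      exact ⟨one_pos, le_rfl⟩
  · by_cases hfx : f x ∈ Z
    · rw [hβf x hfx]
      by_cases hxZ : x ∈ Z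
      · rw [hβZ x hxZ]
        exact min_le_min (hℓ1 x) le_rfl
      · rw [hβn x hxZ]
        exact le_min (hℓ1 x) (hγle x ⟨⟨hx, hfx⟩, hxZ⟩)
    · rw [hβn x fun h => hfx (hZmap h), hβn _ hfx, mul_one]
      exact hℓ1 x
  · by_cases hfx : f x ∈ Z
    · have hxZ : x ∈ Z := by
        by_contra h
        exact hxc (mem_critJulia_of_map_mem_sigmaMax hx hfx h)
      rw [hβf x hfx, hβZ x hxZ, hℓ x hxc]
    · rw [hβn x fun h => hfx (hZmap h), hβn _ hfx, mul_one, hℓ x hxc]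
  · intro S hS hSfin hSJ hfS hsub
    have hSZ : S ⊆ Z := subset_sUnion_of_mem
      (hf.isExceptionalSet_of_diff_subset hS hSfin hSJ hfS (hsub.trans fun c hc => hc.1))
    obtain ⟨s, hs⟩ := hS
    -- For a maximizing `y` one has `L y * γ y = 1`, and `L` does not increase along orbits. So `L *
    -- γ ≤ 1` at the last point before the orbit of `y` first enters `S`, which forces `ℓ * β ∘ f ≤
    -- β` there.
    obtain ⟨y, hy, ⟨m, n, hmn⟩, hγs⟩ := hatt s (hSZ hs)
    have hγy : γ y = (L y)⁻¹ := by rw [← hγs, ← hγn m y, hmn, hγn]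
    have hex : ∃ m, f^[m] y ∈ S := ⟨m, by rw [hmn]; exact hfS.iterate n hs⟩
    obtain ⟨j, hj⟩ : ∃ j, Nat.find hex = j + 1 := by
      refine Nat.exists_eq_succ_of_ne_zero fun h0 => hy.2 (hSZ ?_)
      have := Nat.find_spec hex
      rwa [h0] at this
    have hj1 : f^[j] y ∉ S := Nat.find_min hex (by omega)
    have hj2 : f (f^[j] y) ∈ S := by
      have := Nat.find_spec hex
      rwa [hj, Function.iterate_succ_apply'] at this
    have hLle : ∀ j, L (f^[j] y) ≤ L y := by
      intro j
      induction j with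
      | zero => exact le_rfl
      | succ j ih =>
        rw [Function.iterate_succ_apply']
        refine le_trans ?_ ih
        rw [hLeq (f^[j] y)]
        exact le_mul_of_one_le_left (hLpos _).le (hℓ1 _)
    have hlt := (hsub ⟨⟨hf.mapsTo_julia.iterate j hy.1.1, hj2⟩, hj1⟩).2
    rw [hβf _ (hSZ hj2)] at hlt
    have h1 : L (f^[j] y) * γ (f^[j] y) ≤ 1 := by
      rw [hγn, hγy]
      calc L (f^[j] y) * (L y)⁻¹ ≤ L y * (L y)⁻¹ := by
            gcongr
            · exact inv_nonneg.2 (hLpos y).le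
            · exact hLle j
        _ = 1 := mul_inv_cancel₀ (hLpos y).ne'
    refine absurd hlt (not_lt.2 ((min_le_right _ _).trans ?_))
    by_cases hjZ : f^[j] y ∈ Z
    · rw [hβZ _ hjZ]
      exact le_min h1 le_rfl
    · rw [hβn _ hjZ]
      exact h1

end ClassA

/-! ### Sums of logarithms -/

theorem logAbs_of_ne_zero {x : ℝ} (hx : x ≠ 0) : logAbs x = (Real.log x : EReal) := by
  rw [logAbs, ← ofReal_norm, ENNReal.log_ofReal_of_pos (norm_pos_iff.2 hx), Real.norm_eq_abs,
    Real.log_abs]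

theorem logAbs_ne_top (x : ℝ) : logAbs x ≠ ⊤ := by simp [logAbs]

theorem continuous_logAbs : Continuous logAbs :=
  ENNReal.continuous_log.comp continuous_enorm

theorem sum_coe_mul_logAbs {s : Finset ℝ} {r : ℝ → ℝ} {x : ℝ} (h : ∀ c ∈ s, r c = 0 ∨ x ≠ c) :
    ∑ c ∈ s, (r c : EReal) * logAbs (x - c) =
      ((∑ c ∈ s, r c * Real.log (x - c) : ℝ) : EReal) := by
  induction s using Finset.induction_on with
  | empty => simp
  | insert c s hc ih =>
    rw [Finset.sum_insert hc, Finset.sum_insert hc, EReal.coe_add,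
      ih fun d hd => h d (Finset.mem_insert_of_mem hd)]
    congr 1
    rcases h c (Finset.mem_insert_self _ _) with h | h
    · simp [h]
    · rw [logAbs_of_ne_zero (sub_ne_zero.2 h), EReal.coe_mul]

/-- Addition on `EReal` is discontinuous only at `⊤ + ⊥` and `⊥ + ⊤`; carrying the absence of `⊤`
through the induction avoids both. -/
theorem continuous_sum_and_ne_top {X : Type*} [TopologicalSpace X] {ι : Type*} {s : Finset ι}
    {u : ι → X → EReal} (hc : ∀ i ∈ s, Continuous (u i)) (ht : ∀ i ∈ s, ∀ x, u i x ≠ ⊤) :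
    Continuous (fun x => ∑ i ∈ s, u i x) ∧ ∀ x, ∑ i ∈ s, u i x ≠ ⊤ := by
  classical
  induction s using Finset.induction_on with
  | empty => simp [continuous_const]
  | insert i s hi ih =>
    obtain ⟨h1, h2⟩ := ih (fun j hj => hc j (Finset.mem_insert_of_mem hj))
      fun j hj => ht j (Finset.mem_insert_of_mem hj)
    have h3 := hc i (Finset.mem_insert_self _ _)
    have h4 := ht i (Finset.mem_insert_self _ _)
    simp only [Finset.sum_insert hi]
    refine ⟨continuous_iff_continuousAt.2 fun x => ?_, fun x => EReal.add_ne_top (h4 x) (h2 x)⟩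
    exact (EReal.continuousAt_add (p := (u i x, ∑ j ∈ s, u j x)) (Or.inl (h4 x))
      (Or.inr (h2 x))).comp (f := fun x => (u i x, ∑ j ∈ s, u j x)) (h3.prodMk h1).continuousAt

theorem continuous_sum_and_ne_bot {X : Type*} [TopologicalSpace X] {ι : Type*} {s : Finset ι}
    {u : ι → X → EReal} (hc : ∀ i ∈ s, Continuous (u i)) (hb : ∀ i ∈ s, ∀ x, u i x ≠ ⊥) :
    Continuous (fun x => ∑ i ∈ s, u i x) ∧ ∀ x, ∑ i ∈ s, u i x ≠ ⊥ := by
  classical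
  induction s using Finset.induction_on with
  | empty => simp [continuous_const]
  | insert i s hi ih =>
    obtain ⟨h1, h2⟩ := ih (fun j hj => hc j (Finset.mem_insert_of_mem hj))
      fun j hj => hb j (Finset.mem_insert_of_mem hj)
    have h3 := hc i (Finset.mem_insert_self _ _)
    have h4 := hb i (Finset.mem_insert_self _ _)
    simp only [Finset.sum_insert hi]
    refine ⟨continuous_iff_continuousAt.2 fun x => ?_, fun x =>
      EReal.add_ne_bot_iff.2 ⟨h4 x, h2 x⟩⟩
    exact (EReal.continuousAt_add (p := (u i x, ∑ j ∈ s, u j x)) (Or.inr (h2 x))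
      (Or.inl (h4 x))).comp (f := fun x => (u i x, ∑ j ∈ s, u j x)) (h3.prodMk h1).continuousAt

theorem continuous_coe_mul_logAbs_sub (r c : ℝ) :
    Continuous fun x : ℝ => (r : EReal) * logAbs (x - c) :=
  continuous_iff_continuousAt.2 fun x => by
    rcases eq_or_ne r 0 with rfl | hr
    · simpa using continuousAt_const
    · have hr' : (r : EReal) ≠ 0 := EReal.coe_ne_zero.2 hr
      exact (EReal.continuousAt_mul (p := ((r : EReal), logAbs (x - c))) (Or.inl hr') (Or.inl hr')
        (Or.inl (EReal.coe_ne_bot r)) (Or.inl (EReal.coe_ne_top r))).comp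
        (f := fun x : ℝ => ((r : EReal), logAbs (x - c)))
        (continuous_const.prodMk (continuous_logAbs.comp (continuous_sub_right c))).continuousAt

theorem coe_mul_logAbs_ne_top {r : ℝ} (hr : 0 ≤ r) (x : ℝ) : (r : EReal) * logAbs x ≠ ⊤ := by
  rcases eq_or_ne x 0 with rfl | hx
  · rcases hr.eq_or_lt with rfl | hr
    · simp
    · rw [logAbs_zero, EReal.coe_mul_bot_of_pos hr]
      exact bot_ne_top
  · rw [logAbs_of_ne_zero hx, ← EReal.coe_mul]
    exact EReal.coe_ne_top _

theorem coe_mul_logAbs_ne_bot {r : ℝ} (hr : r ≤ 0) (x : ℝ) : (r : EReal) * logAbs x ≠ ⊥ := by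
  rcases eq_or_ne x 0 with rfl | hx
  · rcases hr.eq_or_lt with rfl | hr
    · simp
    · rw [logAbs_zero, EReal.coe_mul_bot_of_neg hr]
      exact top_ne_bot
  · rw [logAbs_of_ne_zero hx, ← EReal.coe_mul]
    exact EReal.coe_ne_bot _

theorem exists_forall_le_coe {X : Type*} [TopologicalSpace X] [CompactSpace X] {u : X → EReal}
    (hu : Continuous u) (ht : ∀ x, u x ≠ ⊤) : ∃ M : ℝ, ∀ x, u x ≤ (M : EReal) := by
  rcases isEmpty_or_nonempty X with h | h
  · exact ⟨0, fun x => h.elim x⟩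
  · obtain ⟨x₀, -, hx₀⟩ := isCompact_univ.exists_isMaxOn univ_nonempty hu.continuousOn
    exact ⟨(u x₀).toReal, fun x => (hx₀ (mem_univ x)).trans (EReal.le_coe_toReal (ht x₀))⟩

theorem sum_mul_ite_eq {s : Finset ℝ} {r : ℝ → ℝ} {x : ℝ} (h : x ∉ s → r x = 0) (v : ℝ) :
    ∑ c ∈ s, r c * (if x = c then v else 0) = r x * v := by
  simp only [mul_ite, mul_zero]
  rw [Finset.sum_ite_eq]
  split_ifs with hx
  · rfl
  · rw [h hx, zero_mul]

theorem continuousWithinAt_sum_mul_log {s : Finset ℝ} {r F : ℝ → ℝ} {t : Set ℝ} {x : ℝ}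
    (hF : ContinuousWithinAt F t x) (h : ∀ c ∈ s, r c = 0 ∨ F x ≠ c) :
    ContinuousWithinAt (fun y => ∑ c ∈ s, r c * Real.log (F y - c)) t x := by
  refine tendsto_finsetSum _ fun c hc => ?_
  rcases h c hc with h | h
  · simp only [h, zero_mul]
    exact tendsto_const_nhds
  · exact continuousWithinAt_const.mul ((hF.sub continuousWithinAt_const).log (sub_ne_zero.2 h))

/-! ### The pole sum `h` and the regular part of `log |Df| + h ∘ f - h`. -/

namespace ClassA

variable {a b : ℝ} {f : ℝ → ℝ}

theorem poleSum_eq_sum (hf : ClassA a b f) (α : ℝ → ℝ) (x : julia a b f) :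
    poleSum a b f α x =
      ∑ ξ ∈ hf.finite_sigmaMax.toFinset, (α ξ : EReal) * logAbs (x - ξ) :=
  finsum_mem_eq_finite_toFinset_sum _ hf.finite_sigmaMax

theorem continuous_poleSum_and_ne_bot (hf : ClassA a b f) {α : ℝ → ℝ} (hα : ∀ ξ, α ξ ≤ 0) :
    Continuous (poleSum a b f α) ∧ ∀ x, poleSum a b f α x ≠ ⊥ := by
  simp only [funext (hf.poleSum_eq_sum α)]
  exact continuous_sum_and_ne_bot
    (fun ξ _ => (continuous_coe_mul_logAbs_sub (α ξ) ξ).comp continuous_subtype_val)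
    fun ξ _ x => coe_mul_logAbs_ne_bot (hα ξ) _

theorem poleSum_ne_top_iff (hf : ClassA a b f) {α : ℝ → ℝ} (hα : ∀ ξ, α ξ ≤ 0)
    (x : julia a b f) :
    poleSum a b f α x ≠ ⊤ ↔ ∀ ξ ∈ hf.finite_sigmaMax.toFinset, α ξ = 0 ∨ (x : ℝ) ≠ ξ := by
  constructor
  · intro h ξ hξ
    by_contra! hne
    obtain ⟨h0, rfl⟩ := hne
    refine h ?_
    rw [hf.poleSum_eq_sum, ← Finset.add_sum_erase _ _ hξ, sub_self, logAbs_zero,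
      EReal.coe_mul_bot_of_neg (lt_of_le_of_ne (hα _) h0)]
    exact EReal.top_add_of_ne_bot ((continuous_sum_and_ne_bot
      (fun ξ _ => continuous_coe_mul_logAbs_sub (α ξ) ξ)
      fun ξ _ x => coe_mul_logAbs_ne_bot (hα ξ) _).2 (x : ℝ))
  · intro h
    rw [hf.poleSum_eq_sum, sum_coe_mul_logAbs h]
    exact EReal.coe_ne_top _

theorem poleSum_eq_coe (hf : ClassA a b f) {α : ℝ → ℝ} {x : julia a b f}
    (h : ∀ ξ ∈ hf.finite_sigmaMax.toFinset, α ξ = 0 ∨ (x : ℝ) ≠ ξ) :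
    poleSum a b f α x =
      ((∑ ξ ∈ hf.finite_sigmaMax.toFinset, α ξ * Real.log (x - ξ) : ℝ) : EReal) := by
  rw [hf.poleSum_eq_sum, sum_coe_mul_logAbs h]

theorem logSing_log_map_sub (hf : ClassA a b f) {x ℓ : ℝ} (hx : x ∈ Icc a b)
    (hℓ : LogSing (Icc a b) (fun y => Real.log (f y - f x)) x ℓ) (ξ : ℝ) :
    LogSing (Icc a b) (fun y => Real.log (f y - ξ)) x (if f x = ξ then ℓ else 0) := by
  split_ifs with h
  · rwa [← h]
  · obtain ⟨K, hK⟩ := hf.exists_lipschitz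
    have h1 : HolderAt (Icc a b) (fun z => Real.log (z - ξ)) (f x) := by
      refine HolderAt.log ?_ (hf.mapsTo hx) (sub_ne_zero.2 h)
      simpa only [sub_eq_add_neg] using
        (holderAt_id (Icc a b) (f x)).add (holderAt_const (Icc a b) (-ξ) (f x))
    exact (h1.comp_lipschitz hf.mapsTo hx hK).logSing

/-- The Hölder continuous part of `log |Df| + h ∘ f - h`. -/
theorem exists_holder_part (hf : ClassA a b f) {ℓ α β : ℝ → ℝ}
    (hℓ : ∀ x ∈ julia a b f, LogSing (Icc a b) (fun y => Real.log (f y - f x)) x (ℓ x) ∧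
      LogSing (Icc a b) (fun y => Real.log (intervalDeriv a b f y)) x (ℓ x - 1))
    (hα : ∀ x ∉ sigmaMax a b f, α x = 0)
    (hβ : ∀ x ∈ julia a b f, x ∉ critJulia a b f → β x = 0)
    (hαβ : ∀ x ∈ julia a b f, β x = ℓ x - 1 + ℓ x * α (f x) - α x) :
    ∃ g : julia a b f → ℝ, (∃ C r : ℝ≥0, 0 < r ∧ r ≤ 1 ∧ HolderWith C r g) ∧
      ∀ x : julia a b f, (x : ℝ) ∉ critJulia a b f →
        (∀ ξ ∈ hf.finite_sigmaMax.toFinset, α ξ = 0 ∨ (x : ℝ) ≠ ξ) →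
        (∀ ξ ∈ hf.finite_sigmaMax.toFinset, α ξ = 0 ∨ f x ≠ ξ) →
        g x + ∑ c ∈ hf.finite_critJulia.toFinset, β c * Real.log (x - c) =
          Real.log (intervalDeriv a b f x) +
            ∑ ξ ∈ hf.finite_sigmaMax.toFinset, α ξ * Real.log (f x - ξ) -
            ∑ ξ ∈ hf.finite_sigmaMax.toFinset, α ξ * Real.log (x - ξ) := by
  set Z := hf.finite_sigmaMax.toFinset
  set C := hf.finite_critJulia.toFinset
  -- The new potential minus its prescribed logarithmic part. Its coefficient at `x ∈ J` is `ℓ x - 1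
  -- + ℓ x * α (f x) - α x - β x`, which vanishes by `hαβ`.
  let W : ℝ → ℝ := fun y => Real.log (intervalDeriv a b f y) +
    (∑ ξ ∈ Z, α ξ * Real.log (f y - ξ) + ((-1) * ∑ ξ ∈ Z, α ξ * Real.log (y - ξ) +
      (-1) * ∑ c ∈ C, β c * Real.log (y - c)))
  have hW : ∀ x ∈ julia a b f, LogSing (Icc a b) W x 0 := by
    intro x hx
    have h1 := LogSing.sum Z fun ξ _ =>
      (hf.logSing_log_map_sub hx.1 (hℓ x hx).1 ξ).const_mul (α ξ)
    have h2 := LogSing.sum Z fun ξ _ => (logSing_log_sub hx.1 ξ).const_mul (α ξ)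
    have h3 := LogSing.sum C fun c _ => (logSing_log_sub hx.1 c).const_mul (β c)
    rw [sum_mul_ite_eq fun h => hα _ fun h' => h (hf.finite_sigmaMax.mem_toFinset.2 h')]
      at h1 h2
    rw [sum_mul_ite_eq fun h => hβ x hx fun h' => h (hf.finite_critJulia.mem_toFinset.2 h')]
      at h3
    have h4 := (hℓ x hx).2.add (h1.add ((h2.const_mul (-1)).add (h3.const_mul (-1))))
    rw [hαβ x hx] at h4
    convert h4 using 1
    ring
  obtain ⟨g, hg, hgW⟩ := exists_holder_extension hf.lt (isCompact_julia a b f)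
    (fun x hx => hx.1) hW
  refine ⟨g, hg, fun x hxc hx hfx => ?_⟩
  have hxI : (x : ℝ) ∈ Icc a b := x.2.1
  have hd : intervalDeriv a b f x ≠ 0 := fun h => hxc ⟨⟨hxI, h⟩, x.2⟩
  -- `g` is known only as a punctured limit of `W`; continuity away from the poles identifies it
  -- with the value of `W`.
  have hcont : ContinuousWithinAt W (Icc a b) x := by
    refine ((hf.holder_deriv.continuousOn x hxI).log hd).add
      ((continuousWithinAt_sum_mul_log (hf.hasDerivWithinAt hxI).continuousWithinAt hfx).add
      ((continuousWithinAt_const.mul (continuousWithinAt_sum_mul_log continuousWithinAt_id hx)).add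
      (continuousWithinAt_const.mul (continuousWithinAt_sum_mul_log continuousWithinAt_id
        fun c hc => Or.inr ?_))))
    rintro rfl
    exact hxc (hf.finite_critJulia.mem_toFinset.1 hc)
  have := neBot_nhdsWithin_Icc_diff hf.lt hxI
  have h1 : g x = W x := tendsto_nhds_unique (hgW x)
    (hcont.tendsto.mono_left (nhdsWithin_mono _ sdiff_subset))
  rw [h1]
  simp only [W]
  ring

theorem continuous_intervalDeriv (hf : ClassA a b f) :
    Continuous fun x : julia a b f => intervalDeriv a b f x :=
  (hf.holder_deriv.continuousOn.mono fun _ hx => hx.1).domRestrict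

end ClassA

/-! ### Invariance of the hidden pressure. -/

namespace ClassA

variable {a b : ℝ} {f : ℝ → ℝ}

/-- Adding a coboundary `h ∘ f - h` with logarithmic poles does not change the hidden pressure. -/
theorem hiddenPressure_eq_of_coboundary (hf : ClassA a b f) {G : julia a b f → EReal}
    {u H : julia a b f → ℝ} (hG : Continuous G) (hGt : ∀ x, G x ≠ ⊤) (hu : Measurable u)
    (hH : Measurable H) {E : Set (julia a b f)} (hE : E.Finite)
    (hGu : ∀ x ∉ E, G x = (u x : EReal))
    (hcob : ∀ x ∉ E, u x = Real.log (intervalDeriv a b f x) + H (hf.map x) - H x)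
    (hcrit : ∀ x : julia a b f, (x : ℝ) ∈ critJulia a b f → x ∈ E) {s : ℝ} (hs : 0 < s) :
    hiddenPressure hf.map (fun x => (s : EReal) * G x) =
      hiddenPressure hf.map (fun x => (s : EReal) * geomPotential a b f x) := by
  have : CompactSpace (julia a b f) := isCompact_iff_compactSpace.1 (isCompact_julia a b f)
  have hgeom : ∀ x ∉ E, geomPotential a b f x = (Real.log (intervalDeriv a b f x) : EReal) :=
    fun x hx => logAbs_of_ne_zero fun h => hx (hcrit x ⟨⟨x.2.1, h⟩, x.2⟩)
  obtain ⟨M, hM⟩ := exists_forall_le_coe hG hGt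
  obtain ⟨M', hM'⟩ := exists_forall_le_coe
    (continuous_logAbs.comp hf.continuous_intervalDeriv) fun x => logAbs_ne_top _
  have hmeas : Measurable fun x : julia a b f => Real.log (intervalDeriv a b f x) :=
    Real.measurable_log.comp hf.continuous_intervalDeriv.measurable
  -- The free energies agree measure by measure: the entropy does not involve the potential, and a
  -- non-atomic measure gives the finite set `E` mass zero.
  refine iSup_congr fun μ => iSup_congr fun hμ => iSup_congr fun hT => iSup_congr fun hna => ?_
  have hae : ∀ᵐ x ∂μ, x ∉ E := by
    rw [ae_iff]
    simpa using hE.measure_zero μ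
  rw [freeEnergy, freeEnergy]
  congr 1
  refine extIntegral_eq_of_coboundary hT (M := s * max M M') (hu.const_mul s)
    (hmeas.const_mul s) (hH.const_mul s) ?_ ?_ ?_ ?_ ?_
  · filter_upwards [hae] with x hx
    rw [hGu x hx, EReal.coe_mul]
  · filter_upwards [hae] with x hx
    rw [hgeom x hx, EReal.coe_mul]
  · filter_upwards [hae] with x hx
    have h1 := hM x
    rw [hGu x hx, EReal.coe_le_coe_iff] at h1
    exact mul_le_mul_of_nonneg_left (h1.trans (le_max_left _ _)) hs.le
  · filter_upwards [hae] with x hx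
    have h1 : geomPotential a b f x ≤ M' := hM' x
    rw [hgeom x hx, EReal.coe_le_coe_iff] at h1
    exact mul_le_mul_of_nonneg_left (h1.trans (le_max_right _ _)) hs.le
  · filter_upwards [hae] with x hx
    rw [hcob x hx]
    ring

end ClassA

theorem mainTheorem8 {a b : ℝ} {f : ℝ → ℝ} (hf : ClassA a b f) :
    (sigmaMax a b f).Finite ∧
    ∃ α : ℝ → ℝ, (∀ ξ ∈ sigmaMax a b f, -1 < α ξ ∧ α ξ ≤ 0) ∧
      LowerSemicontinuous (poleSum a b f α) ∧
      (∀ x, poleSum a b f α x ≠ ⊥) ∧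
      (∀ x, poleSum a b f α x = ⊤ → (x : ℝ) ∈ sigmaMax a b f) ∧
      ∃ G ∈ classU a b f,
        (∀ x, poleSum a b f α x ≠ ⊤ → poleSum a b f α (hf.map x) ≠ ⊤ →
          G x = geomPotential a b f x + poleSum a b f α (hf.map x) - poleSum a b f α x) ∧
        (∀ t : ℝ, t < 0 →
          hiddenPressure hf.map (fun x => ((-t : ℝ) : EReal) * G x) =
            hiddenPressure hf.map (fun x => ((-t : ℝ) : EReal) * geomPotential a b f x)) ∧
        singularSet a b f G ⊆ critJulia a b f ∧
        ((sigmaMax a b f).Nonempty → singularSet a b f G ⊂ critJulia a b f) ∧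
        ¬ IsExceptional a b f G ∧
        ∀ S : Set ℝ, S.Nonempty → S.Finite → S ⊆ julia a b f → MapsTo f S S →
          ¬ (julia a b f ∩ f ⁻¹' S) \ S ⊆ singularSet a b f G := by
  obtain ⟨ℓ, hℓ1, hℓn, hℓc, hℓ⟩ := hf.exists_order
  obtain ⟨β, hβ, hβn, hβle, hβeq, hexc⟩ := hf.exists_weight hℓ1 hℓn
  -- With `β = 1 + α`, the coefficient `ℓ x - 1 + ℓ x * α (f x) - α x` becomes `ℓ x * β (f x) - β
  -- x`.
  let α : ℝ → ℝ := fun x => β x - 1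
  let m : ℝ → ℝ := fun x => ℓ x * β (f x) - β x
  have hα : ∀ ξ, α ξ ≤ 0 := fun ξ => sub_nonpos.2 (hβ ξ).2
  have hm : ∀ x ∈ julia a b f, 0 ≤ m x := fun x hx => sub_nonneg.2 (hβle x hx)
  obtain ⟨g, hg, hgW⟩ := hf.exists_holder_part (α := α) (β := m) hℓ
    (fun x hx => sub_eq_zero.2 (hβn x hx))
    (fun x hx hxc => sub_eq_zero.2 (hβeq x hx hxc).symm) (fun x _ => by simp only [m, α]; ring)
  let G : julia a b f → EReal := fun x =>
    (g x : EReal) + ∑ᶠ c ∈ critJulia a b f, (m c : EReal) * logAbs (x - c)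
  have hGrep : IsLogRep a b f G g m := ⟨hg, fun c hc => hm c hc.2, fun _ => rfl⟩
  have hGsum : ∀ x, G x = (g x : EReal) +
      ∑ c ∈ hf.finite_critJulia.toFinset, (m c : EReal) * logAbs (x - c) := fun x => by
    simp only [G]
    rw [finsum_mem_eq_finite_toFinset_sum _ hf.finite_critJulia]
  have hgc : Continuous g := by
    obtain ⟨C, r, hr, -, h⟩ := hg
    exact h.continuous hr
  have hsing : singularSet a b f G = {c ∈ critJulia a b f | β c < ℓ c * β (f c)} := by
    rw [singularSet_eq hGrep hf.finite_critJulia]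
    simp only [m, sub_pos]
  obtain ⟨hsc, hst⟩ := continuous_sum_and_ne_top (s := hf.finite_critJulia.toFinset)
    (u := fun c (x : julia a b f) => (m c : EReal) * logAbs (x - c))
    (fun c _ => (continuous_coe_mul_logAbs_sub (m c) c).comp continuous_subtype_val)
    fun c hc x => coe_mul_logAbs_ne_top (hm c (hf.finite_critJulia.mem_toFinset.1 hc).2) _
  have hGt : ∀ x, G x ≠ ⊤ := fun x => by
    rw [hGsum]
    exact EReal.add_ne_top (EReal.coe_ne_top _) (hst x)
  have hGc : Continuous G := by
    rw [funext hGsum]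
    refine continuous_iff_continuousAt.2 fun x => ?_
    exact (EReal.continuousAt_add (Or.inl (EReal.coe_ne_top (g x)))
      (Or.inl (EReal.coe_ne_bot (g x)))).comp
      ((continuous_coe_real_ereal.comp hgc).prodMk hsc).continuousAt
  have hGreal : ∀ x : julia a b f, (x : ℝ) ∉ critJulia a b f → G x =
      ((g x + ∑ c ∈ hf.finite_critJulia.toFinset, m c * Real.log (x - c) : ℝ) : EReal) := by
    intro x hx
    rw [hGsum, sum_coe_mul_logAbs, EReal.coe_add]
    rintro c hc
    right
    rintro rfl
    exact hx (hf.finite_critJulia.mem_toFinset.1 hc)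
  refine ⟨hf.finite_sigmaMax, α, fun ξ _ => ⟨by have := (hβ ξ).1; simp only [α]; linarith, hα ξ⟩,
    (hf.continuous_poleSum_and_ne_bot hα).1.lowerSemicontinuous,
    (hf.continuous_poleSum_and_ne_bot hα).2, fun x hx => ?_, G,
    ⟨hGc.upperSemicontinuous, hGt, g, m, hGrep⟩, fun x hx hfx => ?_, fun t ht => ?_, ?_, ?_, ?_, ?_⟩
  · by_contra hxZ
    refine (hf.poleSum_ne_top_iff hα x).2 (fun ξ hξ => Or.inr ?_) hx
    rintro rfl
    exact hxZ (hf.finite_sigmaMax.mem_toFinset.1 hξ)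
  · rw [hf.poleSum_ne_top_iff hα] at hx hfx
    rw [hf.poleSum_eq_coe hx, hf.poleSum_eq_coe hfx]
    -- If `h` is finite at `x` and `f x`, then `α` vanishes at both, so at a critical point `m x = ℓ
    -- x - 1 > 0` and both sides are `⊥`.
    by_cases hxc : (x : ℝ) ∈ critJulia a b f
    · have hα0 : ∀ y : julia a b f, (∀ ξ ∈ hf.finite_sigmaMax.toFinset, α ξ = 0 ∨ (y : ℝ) ≠ ξ) →
          β y = 1 := by
        intro y hy
        by_cases hyZ : (y : ℝ) ∈ sigmaMax a b f
        · exact sub_eq_zero.1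
            ((hy y (hf.finite_sigmaMax.mem_toFinset.2 hyZ)).resolve_right fun h => h rfl)
        · exact hβn y hyZ
      have hmx : 0 < m x := by
        have h1 : β (f x) = 1 := hα0 (hf.map x) hfx
        have h2 := hℓc x hxc
        simp only [m]
        rw [h1, hα0 x hx]
        linarith
      have hbot : G x = ⊥ := (hGrep.eq_bot_iff hf.finite_critJulia x hxc).2 hmx
      have hgeom : geomPotential a b f x = ⊥ := by
        rw [geomPotential, hxc.1.2, logAbs_zero]
      rw [hbot, hgeom, EReal.bot_add, EReal.bot_sub]
    · have hd : intervalDeriv a b f x ≠ 0 := fun h => hxc ⟨⟨x.2.1, h⟩, x.2⟩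
      rw [hGreal x hxc, hgW x hxc hx hfx, geomPotential, logAbs_of_ne_zero hd, ← EReal.coe_add,
        ← EReal.coe_sub]
      rfl
  · let E : Set (julia a b f) := {x | (x : ℝ) ∈ critJulia a b f ∨ (x : ℝ) ∈ sigmaMax a b f ∨
      (x : ℝ) ∈ Icc a b ∩ f ⁻¹' sigmaMax a b f}
    have hE : E.Finite := Set.Finite.preimage Subtype.val_injective.injOn
      (hf.finite_critJulia.union (hf.finite_sigmaMax.union
        (hf.finite_preimage hf.finite_sigmaMax)))
    have hlog : ∀ (s : Finset ℝ) (r : ℝ → ℝ), Measurable fun x : julia a b f =>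
        ∑ c ∈ s, r c * Real.log (x - c) := fun s r => by fun_prop
    refine hf.hiddenPressure_eq_of_coboundary hGc hGt
      (u := fun x => g x + ∑ c ∈ hf.finite_critJulia.toFinset, m c * Real.log (x - c))
      (H := fun x => ∑ ξ ∈ hf.finite_sigmaMax.toFinset, α ξ * Real.log (x - ξ))
      (hgc.measurable.add (hlog _ _)) (hlog _ _) hE (fun x hx => hGreal x fun h => hx (Or.inl h))
      (fun x hx => ?_) (fun x hx => Or.inl hx) (neg_pos.2 ht)
    refine hgW x (fun h => hx (Or.inl h)) (fun ξ hξ => Or.inr ?_) fun ξ hξ => Or.inr ?_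
    · rintro rfl
      exact hx (Or.inr (Or.inl (hf.finite_sigmaMax.mem_toFinset.1 hξ)))
    · rintro rfl
      exact hx (Or.inr (Or.inr ⟨x.2.1, hf.finite_sigmaMax.mem_toFinset.1 hξ⟩))
  · exact fun c hc => hc.1
  · intro hne
    refine ⟨fun c hc => hc.1, fun hsub => ?_⟩
    -- If every point of `Crit'` were singular for `G`, then `Σ_max` itself would be a forbidden
    -- set, since `f⁻¹(Σ_max) \ Σ_max ⊆ Crit'`.
    refine hexc _ hne hf.finite_sigmaMax (ClassA.sigmaMax_subset_julia a b f)
      (ClassA.mapsTo_sigmaMax a b f) ?_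
    rw [← hsing]
    exact fun x hx => hsub (ClassA.mem_critJulia_of_map_mem_sigmaMax hx.1.1 hx.1.2 hx.2)
  · rintro ⟨S, hS⟩
    refine hexc S hS.nonempty hS.finite hS.subset_julia hS.forward ?_
    rw [← hsing]
    exact hS.diff_subset
  · intro S hS hSfin hSJ hfS
    rw [hsing]
    exact hexc S hS hSfin hSJ hfS
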